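/- **Conventions.** A *weighting* $\lambda=(\lambda_1,\dots,\lambda_n)$ of the variables $x_1,\dots,x_n$ takes values $\lambda_i\ge 0$ in a totally ordered cancellative commutative monoid (for example $\mathbb N$, or $\mathbb N[\varepsilon]$ with $\varepsilon$ infinitesimal; every term order is of this kind). Fix one. The initial form $\operatorname{init} g$ of a polynomial $g$ is the sum of the terms $c\prod_i x_i^{e_i}$ of $g$ with $\sum_i e_i\lambda_i$ maximal; $\operatorname{init} I$ is the span of $\{\operatorname{init} g: g\in I\}$. A Gröbner basis of an ideal $I$ is a finite subset of $I$ whose initial forms generate $\operatorname{init} I$; a Gröbner basis of a closed subscheme is one of its ideal. $\operatorname{Tr}$ is the additive map on $\mathbb F_p[x_1,\dots,x_n]$ with $\operatorname{Tr}(c\prod_i x_i^{e_i}) = c\prod_i x_i^{(e_i+1)/p-1}$ if $p\mid e_i+1$ for all $i$, and $0$ otherwise. A *Frobenius splitting* of a ring of characteristic $p$ is an additive map $\varphi$ with $\varphi(a^pb)=a\varphi(b)$ and $\varphi(1)=1$; on a scheme of characteristic $p$ it is a family of such maps on the sections over open sets, compatible with restriction. An ideal (sheaf) $I$, and the closed subscheme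 it defines, is *compatibly split* by $\varphi$ if $\varphi(I)\subseteq I$; the same term is used for the additive maps $\operatorname{Tr}(f^{p-1}\bullet): g\mapsto\operatorname{Tr}(f^{p-1}g)$. For $f\in\mathbb Z[x_1,\dots,x_n]$ and an infinite set $P$ of primes, a subvariety $Y\subseteq\mathbb A^n_{\mathbb Q}$ with ideal $I$ is *compatibly split with respect to $\operatorname{Tr}(f^{p-1}\bullet)$, $p\in P$*, if for every $p\in P$ the image of $I\cap\mathbb Z[x_1,\dots,x_n]$ in $\mathbb F_p[x_1,\dots,x_n]$ is compatibly split by $\operatorname{Tr}((f\bmod p)^{p-1}\bullet)$. Subvarieties are closed, reduced and irreducible. An element $p$ of a poset is *basic* if it is not the greatest lower bound of $\{q:q>p\}$. Sets $\mathcal Y$ of subvarieties are ordered by inclusion. Call a set $\mathcal Y$ of subvarieties of a scheme $X$ *admissible* if every irreducible component of the intersection of two members of $\mathcal Y$ is again in $\mathcal Y$, and if the greatest element of $\mathcal Y$, in case there is one, is $X$ itself. For $Y\in\mathcal Y$ let $B(Y)=\{Z\in\mathcal Y: Z\supseteq Y,\ Z\text{ basic in }\mathcal Y\}$. The intersection of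 an empty family of subvarieties of $X$ is $X$. **Theorem.** Let $f\in\mathbb Z[x_1,\dots,x_n]$ have degree $n$ with $\operatorname{init} f=\prod_{i=1}^n x_i$, let $P$ be an infinite set of primes, and let $\mathcal Y_f$ be a set (not necessarily all) of subvarieties of $\mathbb A^n_{\mathbb Q}$ that are compatibly split with respect to $\operatorname{Tr}(f^{p-1}\bullet)$, $p\in P$. 1. Each $Y\in\mathcal Y_f$ has a Gröbner basis $(g_i)$ whose initial forms $\operatorname{init} g_i$ are squarefree monomials. Assume now that $\mathcal Y_f$ is admissible. 2. Each $Y\in\mathcal Y_f$ is the scheme-theoretic intersection of $B(Y)$, and also of the set of minimal elements of $B(Y)$. 3. For each $Y\in\mathcal Y_f$, the concatenation of Gröbner bases of the minimal elements of $B(Y)$ is a Gröbner basis of $Y$. Moreover: * (2) holds for every finite admissible set $\mathcal Y$ of compatibly split subvarieties of any scheme with a Frobenius splitting. * (3) holds for any $f\in\mathbb Z[x_1,\dots,x_n]$, any infinite set $P$ of primes such that $\operatorname{Tr}((\operatorname{init} f)^{p-1}\bullet)$ is a Frobenius splitting of $\mathbb F_p[x_1,\dots,x_n]$ for all $p\in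 P$, and any finite admissible set of subvarieties of $\mathbb A^n_{\mathbb Q}$ that are compatibly split with respect to $\operatorname{Tr}(f^{p-1}\bullet)$, $p\in P$. * (3) also holds over $\mathbb F_p$: for any prime $p$ and $f\in\mathbb F_p[x_1,\dots,x_n]$ such that $\operatorname{Tr}((\operatorname{init} f)^{p-1}\bullet)$ is a Frobenius splitting, and any finite admissible set of subvarieties of $\mathbb A^n_{\mathbb F_p}$ that are compatibly split by $\operatorname{Tr}(f^{p-1}\bullet)$. -/

import Mathlib

open MvPolynomial

universe u

noncomputable section

/-! ## Posets and basic elements -/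

/-- An element `p` of a poset is *basic* if it is not the greatest lower bound of the set of
elements strictly above it. -/
def IsBasic {P : Type*} [PartialOrder P] (p : P) : Prop :=
  ¬ IsGLB {q : P | p < q} p

/-- The elements of `YY` that lie above `Y` and are basic in the poset `YY`
(with the order induced from the ambient type). -/
def basicAbove {V : Type*} [PartialOrder V] (YY : Set V) (Y : V) : Set V :=
  {Z | ∃ hZ : Z ∈ YY, IsBasic (⟨Z, hZ⟩ : YY) ∧ Y ≤ Z}

/-- The minimal elements of `basicAbove YY Y`. -/
def minimalBasicAbove {V : Type*} [PartialOrder V] (YY : Set V) (Y : V) : Set V :=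
  {Z | Minimal (fun W => W ∈ basicAbove YY Y) Z}

/-- For a set `YY` of subvarieties (ordered by inclusion) of an ambient space: every irreducible
component of the intersection of two members of `YY` is in `YY`. The irreducible components of
`Y ∩ Z` are the maximal subvarieties contained in both `Y` and `Z`. -/
def ClosedUnderComponents {V : Type*} [PartialOrder V] (YY : Set V) : Prop :=
  ∀ Y ∈ YY, ∀ Z ∈ YY, ∀ W : V, Maximal (fun T => T ≤ Y ∧ T ≤ Z) W → W ∈ YY

/-! ## Subvarieties -/

/-- A closed subvariety (reduced and irreducible) of the affine scheme `Spec R`,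
given by its prime ideal. -/
@[ext] structure AffineSubvariety (R : Type*) [CommRing R] where
  /-- The ideal of functions vanishing on the subvariety. -/
  ideal : Ideal R
  isPrime : ideal.IsPrime

/-- Subvarieties are ordered by inclusion, that is, by reverse inclusion of ideals. -/
instance AffineSubvariety.instPartialOrder (R : Type*) [CommRing R] :
    PartialOrder (AffineSubvariety R) :=
  PartialOrder.lift (fun Y => OrderDual.toDual Y.ideal)
    (fun _ _ h => AffineSubvariety.ext (OrderDual.toDual.injective h))

/-- A closed subvariety (an integral closed subscheme) of a scheme `X`,
given by its quasi-coherent ideal sheaf. -/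
@[ext] structure SchemeSubvariety (X : AlgebraicGeometry.Scheme.{u}) where
  /-- The ideal sheaf of the subvariety. -/
  ideal : X.IdealSheafData
  isIntegral : AlgebraicGeometry.IsIntegral ideal.subscheme

/-- Subvarieties are ordered by inclusion, that is, by reverse inclusion of ideal sheaves. -/
instance SchemeSubvariety.instPartialOrder (X : AlgebraicGeometry.Scheme.{u}) :
    PartialOrder (SchemeSubvariety X) :=
  PartialOrder.lift (fun Y => OrderDual.toDual Y.ideal)
    (fun _ _ h => SchemeSubvariety.ext (OrderDual.toDual.injective h))

/-! ## Initial forms, initial ideals, Gröbner bases -/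

section Initial

variable {n : ℕ} {R : Type*} [CommRing R]
variable {Γ : Type*} [AddCommMonoid Γ] [LinearOrder Γ]

/-- The initial (leading) form of `g` for the weighting `w` of the variables: the sum of the terms
`c ∏ x_i ^ e_i` of `g` for which the weight `∑ e_i • w i` is maximal. -/
def initForm (w : Fin n → Γ) (g : MvPolynomial (Fin n) R) : MvPolynomial (Fin n) R :=
  ∑ e ∈ g.support with ∀ d ∈ g.support, Finsupp.weight w d ≤ Finsupp.weight w e,
    monomial e (coeff e g)

/-- The initial ideal of `I`, spanned by the initial forms of all elements of `I`. -/
def initIdeal (w : Fin n → Γ) (I : Ideal (MvPolynomial (Fin n) R)) :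
    Ideal (MvPolynomial (Fin n) R) :=
  Ideal.span (initForm w '' (I : Set (MvPolynomial (Fin n) R)))

/-- A Gröbner basis of `I` for the weighting `w` : a finite subset of `I` whose initial forms
generate the initial ideal of `I`. -/
structure IsGroebnerBasis (w : Fin n → Γ) (I : Ideal (MvPolynomial (Fin n) R))
    (G : Set (MvPolynomial (Fin n) R)) : Prop where
  finite : G.Finite
  subset : G ⊆ (I : Set (MvPolynomial (Fin n) R))
  span_init : Ideal.span (initForm w '' G) = initIdeal w I

end Initial

/-! ## Frobenius splittings of rings and the trace on polynomial rings -/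

/-- A Frobenius splitting of a commutative ring of characteristic `p`. -/
structure IsFrobeniusSplitting (p : ℕ) {R : Type*} [CommRing R] (φ : R → R) : Prop where
  map_add : ∀ a b, φ (a + b) = φ a + φ b
  map_pow_mul : ∀ a b, φ (a ^ p * b) = a * φ b
  map_one : φ 1 = 1

/-- The ideal `I` is compatibly split by `φ`, i.e. `φ(I) ⊆ I`. -/
def IsCompatiblySplit {R : Type*} [CommRing R] (φ : R → R) (I : Ideal R) : Prop :=
  ∀ a ∈ I, φ a ∈ I

/-- The near-splitting `Tr` of `𝔽_p[x_1, …, x_n]`: the additive map that sends `c ∏ x_i ^ e_i`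
to `c ∏ x_i ^ ((e_i + 1) / p - 1)` if `p` divides all `e_i + 1`, and to `0` otherwise.
Coefficients in `𝔽_p` are their own `p`-th roots. -/
def frobTrace (p : ℕ) {n : ℕ} (g : MvPolynomial (Fin n) (ZMod p)) :
    MvPolynomial (Fin n) (ZMod p) :=
  ∑ e ∈ g.support with ∀ i, p ∣ e i + 1,
    monomial (Finsupp.equivFunOnFinite.symm fun i => (e i + 1) / p - 1) (coeff e g)

/-- The near-splitting `Tr(f^{p-1} •)` of `𝔽_p[x_1, …, x_n]`. -/
def traceMap (p : ℕ) {n : ℕ} (f : MvPolynomial (Fin n) (ZMod p)) :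
    MvPolynomial (Fin n) (ZMod p) → MvPolynomial (Fin n) (ZMod p) :=
  fun g => frobTrace p (f ^ (p - 1) * g)

/-! ## Reduction modulo a prime -/

/-- Reduction mod `p` of an integer polynomial. -/
def reducePoly (p : ℕ) {n : ℕ} (f : MvPolynomial (Fin n) ℤ) : MvPolynomial (Fin n) (ZMod p) :=
  MvPolynomial.map (Int.castRingHom (ZMod p)) f

/-- Reduction mod `p` of an ideal of `ℚ[x_1, …, x_n]`: the image in `𝔽_p[x_1, …, x_n]` of its
intersection with `ℤ[x_1, …, x_n]`. It defines the fibre over `p` of the closure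
in affine space over `ℤ` of the subscheme of affine space over `ℚ`. -/
def reduceIdeal (p : ℕ) {n : ℕ} (I : Ideal (MvPolynomial (Fin n) ℚ)) :
    Ideal (MvPolynomial (Fin n) (ZMod p)) :=
  (I.comap (MvPolynomial.map (Int.castRingHom ℚ))).map
    (MvPolynomial.map (Int.castRingHom (ZMod p)))

/-- The subvariety `Y` of affine space over `ℚ` is compatibly split with respect to
`Tr(f^{p-1} •)` for all `p` in the set `P`. -/
def IsCompatiblySplitOver {n : ℕ} (f : MvPolynomial (Fin n) ℤ) (P : Set ℕ)
    (Y : AffineSubvariety (MvPolynomial (Fin n) ℚ)) : Prop :=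
  ∀ p ∈ P, IsCompatiblySplit (traceMap p (reducePoly p f)) (reduceIdeal p Y.ideal)

/-! ## Frobenius splittings of schemes -/

open AlgebraicGeometry CategoryTheory in
/-- A Frobenius splitting of a scheme `X` of characteristic `p`: an `𝒪_X`-linear map
`F_* 𝒪_X → 𝒪_X` (where `F` is the absolute Frobenius morphism) sending `1` to `1`. -/
structure SchemeFrobeniusSplitting (p : ℕ) (X : Scheme.{u}) where
  char_eq : (p : Γ(X, ⊤)) = 0
  /-- The map on sections over an open subset. -/
  toFun : ∀ U : X.Opens, Γ(X, U) → Γ(X, U)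
  isSplitting : ∀ U : X.Opens, IsFrobeniusSplitting p (toFun U)
  naturality : ∀ (U V : X.Opens) (h : V ≤ U) (a : Γ(X, U)),
    toFun V ((X.presheaf.map (homOfLE h).op).hom a) =
      (X.presheaf.map (homOfLE h).op).hom (toFun U a)

/-- The subvariety `Y` of `X` is compatibly split: `φ` maps its ideal sheaf into itself. -/
def SchemeSubvariety.IsCompatiblySplit {p : ℕ} {X : AlgebraicGeometry.Scheme.{u}}
    (φ : SchemeFrobeniusSplitting p X) (Y : SchemeSubvariety X) : Prop :=
  ∀ U : X.affineOpens, _root_.IsCompatiblySplit (φ.toFun U) (Y.ideal.ideal U)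

end

/-! Compatible splitting survives degeneration. If `Tr(f^{p-1} •)` maps `I` into itself, comparing
terms of top weight shows that `Tr((init f)^{p-1} •)` maps `init I` into itself
(`IsCompatiblySplit.initIdeal`); if the latter map is a splitting, `init I` is radical. Compatibly
split ideals are closed under sums and intersections, so they form a lattice of ideals with radical
initial ideals. Always `init I * init J ≤ init (I ⊓ J)`, so radicality makes `init` commute with
intersections. It then commutes with sums too, because leading parts that cancel in `a + b` lift to
`I ⊓ J` (`initIdeal_sup_of_initIdeal_inf`). Commuting with sums is what makes Gröbner bases
concatenate.

Sums of compatibly split ideals are radical, so an intersection of members of the family is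
determined by the subvarieties it contains. In a finite poset each element is the greatest lower
bound of the basic elements above it, and admissibility turns this into an equality of ideals
(`eq_iSup_basicAbove`).

Over `ℚ`, reduction mod `p` commutes with sums, intersections and initial ideals for almost all `p`,
and an integral polynomial lying in infinitely many reductions of an ideal lies in the ideal
(`map_mem_of_frequently`). Properties of initial ideals thus pass from `𝔽_p` to `ℚ`. If `init f = ∏
x_i`, the initial ideals are generated by squarefree monomials. There are finitely many such ideals,
and in the lattice the initial ideal determines the ideal, so the family is automatically finite. -/

noncomputable section

set_option linter.unusedSectionVars false

/-! ### The filtration of the polynomial ring by weight. -/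

section WeightFiltration

variable {n : ℕ} {R : Type*} [CommRing R]
variable {Γ : Type*} [AddCommMonoid Γ] [LinearOrder Γ]

/-- All terms of `g` have weight at most `γ`. -/
def WeightLE (w : Fin n → Γ) (γ : Γ) (g : MvPolynomial (Fin n) R) : Prop :=
  ∀ d, coeff d g ≠ 0 → Finsupp.weight w d ≤ γ

/-- All terms of `g` have weight less than `γ`. -/
def WeightLT (w : Fin n → Γ) (γ : Γ) (g : MvPolynomial (Fin n) R) : Prop :=
  ∀ d, coeff d g ≠ 0 → Finsupp.weight w d < γ

variable {w : Fin n → Γ} {γ δ : Γ} {g h : MvPolynomial (Fin n) R}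

theorem WeightLT.weightLE (hg : WeightLT w γ g) : WeightLE w γ g :=
  fun d hd => (hg d hd).le

theorem WeightLE.mono (hg : WeightLE w γ g) (h : γ ≤ δ) : WeightLE w δ g :=
  fun d hd => (hg d hd).trans h

theorem WeightLE.lt (hg : WeightLE w γ g) (h : γ < δ) : WeightLT w δ g :=
  fun d hd => (hg d hd).trans_lt h

theorem weightLT_zero : WeightLT w γ (0 : MvPolynomial (Fin n) R) := by
  intro d hd
  simp at hd

theorem WeightLE.add (hg : WeightLE w γ g) (hh : WeightLE w γ h) : WeightLE w γ (g + h) := by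
  intro d hd
  by_cases h1 : coeff d g = 0
  · refine hh d fun h2 => hd ?_
    rw [coeff_add, h1, h2, add_zero]
  · exact hg d h1

theorem WeightLE.neg (hg : WeightLE w γ g) : WeightLE w γ (-g) := by
  intro d hd
  rw [coeff_neg, neg_ne_zero] at hd
  exact hg d hd

theorem WeightLE.sub (hg : WeightLE w γ g) (hh : WeightLE w γ h) : WeightLE w γ (g - h) := by
  rw [sub_eq_add_neg]
  exact hg.add hh.neg

theorem WeightLE.C_mul (hg : WeightLE w γ g) (c : R) : WeightLE w γ (C c * g) := by
  intro d hd
  rw [coeff_C_mul] at hd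
  exact hg d (right_ne_zero_of_mul hd)

theorem WeightLT.add (hg : WeightLT w γ g) (hh : WeightLT w γ h) : WeightLT w γ (g + h) := by
  intro d hd
  by_cases h1 : coeff d g = 0
  · refine hh d fun h2 => hd ?_
    rw [coeff_add, h1, h2, add_zero]
  · exact hg d h1

theorem exists_coeff_ne_zero_of_mul {d : Fin n →₀ ℕ} (hd : coeff d (g * h) ≠ 0) :
    ∃ a b, a + b = d ∧ coeff a g ≠ 0 ∧ coeff b h ≠ 0 := by
  classical
  rw [coeff_mul] at hd
  obtain ⟨x, hx, hne⟩ := Finset.exists_ne_zero_of_sum_ne_zero hd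
  exact ⟨x.1, x.2, by simpa using hx, left_ne_zero_of_mul hne,
    right_ne_zero_of_mul hne⟩

theorem WeightLE.map {S : Type*} [CommRing S] (φ : R →+* S) (hg : WeightLE w γ g) :
    WeightLE w γ (MvPolynomial.map φ g) := by
  intro d hd
  rw [coeff_map] at hd
  exact hg d fun h => hd (by rw [h, map_zero])

theorem map_weightedHomogeneousComponent {S : Type*} [CommRing S] (φ : R →+* S) (γ : Γ)
    (g : MvPolynomial (Fin n) R) :
    MvPolynomial.map φ (weightedHomogeneousComponent w γ g) =
      weightedHomogeneousComponent w γ (MvPolynomial.map φ g) := by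
  ext d
  simp only [coeff_map, coeff_weightedHomogeneousComponent]
  split_ifs <;> simp

theorem weightLE_weightedHomogeneousComponent (γ : Γ) (g : MvPolynomial (Fin n) R) :
    WeightLE w γ (weightedHomogeneousComponent w γ g) := by
  intro d hd
  rw [coeff_weightedHomogeneousComponent] at hd
  by_contra hlt
  exact hd (if_neg fun h => hlt h.le)

theorem WeightLE.weightLT_iff (hg : WeightLE w γ g) :
    WeightLT w γ g ↔ weightedHomogeneousComponent w γ g = 0 := by
  constructor
  · intro hlt
    ext d
    rw [coeff_weightedHomogeneousComponent, coeff_zero]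
    split_ifs with hd
    · by_contra hne
      exact (hlt d hne).ne hd
    · rfl
  · intro h0 d hd
    refine lt_of_le_of_ne (hg d hd) fun heq => hd ?_
    have := congrArg (coeff d) h0
    rwa [coeff_weightedHomogeneousComponent, if_pos heq, coeff_zero] at this

theorem weightedHomogeneousComponent_self (γ : Γ) (g : MvPolynomial (Fin n) R) :
    weightedHomogeneousComponent w γ (weightedHomogeneousComponent w γ g) =
      weightedHomogeneousComponent w γ g :=
  weightedHomogeneousComponent_eq_self (weightedHomogeneousComponent_isWeightedHomogeneous ..)

theorem weightedHomogeneousComponent_of_ne (hne : δ ≠ γ) (g : MvPolynomial (Fin n) R) :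
    weightedHomogeneousComponent w δ (weightedHomogeneousComponent w γ g) = 0 := by
  ext d
  simp only [coeff_weightedHomogeneousComponent, coeff_zero]
  split_ifs with h1 h2 <;> simp_all

theorem WeightLE.weightLT_sub (hg : WeightLE w γ g)
    (hh : WeightLE w γ h)
    (heq : weightedHomogeneousComponent w γ g = weightedHomogeneousComponent w γ h) :
    WeightLT w γ (g - h) := by
  rw [(hg.sub hh).weightLT_iff, map_sub, heq, sub_self]

section Mul

variable [IsOrderedCancelAddMonoid Γ]

theorem WeightLE.mul (hg : WeightLE w γ g) (hh : WeightLE w δ h) :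
    WeightLE w (γ + δ) (g * h) := by
  intro d hd
  obtain ⟨a, b, rfl, ha, hb⟩ := exists_coeff_ne_zero_of_mul hd
  rw [map_add]
  exact add_le_add (hg a ha) (hh b hb)

theorem WeightLT.mul (hg : WeightLT w γ g) (hh : WeightLE w δ h) :
    WeightLT w (γ + δ) (g * h) := by
  intro d hd
  obtain ⟨a, b, rfl, ha, hb⟩ := exists_coeff_ne_zero_of_mul hd
  rw [map_add]
  exact add_lt_add_of_lt_of_le (hg a ha) (hh b hb)

theorem WeightLE.mul_weightLT (hg : WeightLE w γ g) (hh : WeightLT w δ h) :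
    WeightLT w (γ + δ) (g * h) := by
  rw [mul_comm g, add_comm]
  exact hh.mul hg

/-- By cancellation in `Γ`, a product involving a lower term has weight strictly below `γ + δ`.
Working with components at a prescribed bound, possibly zero, avoids any need for `R` to be a
domain. -/
theorem WeightLE.weightedHomogeneousComponent_mul (hg : WeightLE w γ g) (hh : WeightLE w δ h) :
    weightedHomogeneousComponent w (γ + δ) (g * h) =
      weightedHomogeneousComponent w γ g * weightedHomogeneousComponent w δ h := by
  set g' := weightedHomogeneousComponent w γ g with hg'
  set h' := weightedHomogeneousComponent w δ h with hh'
  have hgl : WeightLT w γ (g - g') :=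
    hg.weightLT_sub (weightLE_weightedHomogeneousComponent γ g)
      (weightedHomogeneousComponent_self γ g).symm
  have hhl : WeightLT w δ (h - h') :=
    hh.weightLT_sub (weightLE_weightedHomogeneousComponent δ h)
      (weightedHomogeneousComponent_self δ h).symm
  have hlt : WeightLT w (γ + δ) ((g - g') * h + g' * (h - h')) :=
    (hgl.mul hh).add ((weightLE_weightedHomogeneousComponent γ g).mul_weightLT hhl)
  have heq : g * h = g' * h' + ((g - g') * h + g' * (h - h')) := by ring
  rw [heq, map_add, (hlt.weightLE.weightLT_iff).mp hlt, add_zero]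
  exact weightedHomogeneousComponent_eq_self
    ((weightedHomogeneousComponent_isWeightedHomogeneous ..).mul
      (weightedHomogeneousComponent_isWeightedHomogeneous ..))

theorem weightLE_one : WeightLE w 0 (1 : MvPolynomial (Fin n) R) := by
  classical
  intro d hd
  rw [coeff_one] at hd
  by_cases h : 0 = d
  · simp [← h]
  · simp [h] at hd

theorem WeightLE.pow (hg : WeightLE w γ g) (m : ℕ) : WeightLE w (m • γ) (g ^ m) := by
  induction m with
  | zero => simpa using weightLE_one
  | succ m ih =>
    rw [pow_succ, succ_nsmul]
    exact ih.mul hg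

theorem WeightLE.weightedHomogeneousComponent_pow (hg : WeightLE w γ g) (m : ℕ) :
    weightedHomogeneousComponent w (m • γ) (g ^ m) = weightedHomogeneousComponent w γ g ^ m := by
  induction m with
  | zero =>
    simp only [zero_nsmul, pow_zero]
    exact weightedHomogeneousComponent_eq_self (isWeightedHomogeneous_one R w)
  | succ m ih =>
    rw [pow_succ, pow_succ, succ_nsmul, (hg.pow m).weightedHomogeneousComponent_mul hg, ih]

theorem weightedHomogeneousComponent_natCast_mul (N : ℕ) (γ : Γ) (g : MvPolynomial (Fin n) R) :
    weightedHomogeneousComponent w γ ((N : MvPolynomial (Fin n) R) * g) =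
      N * weightedHomogeneousComponent w γ g := by
  rw [← nsmul_eq_mul, map_nsmul, nsmul_eq_mul]

/-- Weights of monomials are well-ordered, by Dickson's lemma; hence induction on the
weight filtration. -/
theorem weight_induction (hw : ∀ i, 0 ≤ w i) {P : MvPolynomial (Fin n) R → Prop} (h0 : P 0)
    (step : ∀ γ g, WeightLE w γ g → (∀ g', WeightLT w γ g' → P g') → P g)
    (g : MvPolynomial (Fin n) R) : P g := by
  have hmono : Monotone (Finsupp.weight w : (Fin n →₀ ℕ) → Γ) := by
    intro a b hab
    obtain ⟨c, rfl⟩ := exists_add_of_le hab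
    rw [map_add]
    refine le_add_of_nonneg_right ?_
    rw [Finsupp.weight_apply]
    exact Finset.sum_nonneg fun i _ => nsmul_nonneg (hw i) _
  have hwf : (Set.range (Finsupp.weight w : (Fin n →₀ ℕ) → Γ)).IsWF := by
    rw [← Set.image_univ]
    exact ((Set.isPWO_of_wellQuasiOrderedLE Set.univ).image_of_monotone hmono).isWF
  have key : ∀ γ ∈ Set.range (Finsupp.weight w : (Fin n →₀ ℕ) → Γ), ∀ g, WeightLE w γ g → P g := by
    intro γ hγ
    refine Set.WellFoundedOn.induction (P := fun γ => ∀ g, WeightLE w γ g → P g) hwf hγ ?_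
    rintro γ hγ ih g hg
    refine step γ g hg fun g' hg' => ?_
    by_cases hz : g' = 0
    · exact hz ▸ h0
    · obtain ⟨d, hd, hmax⟩ := Finset.exists_max_image g'.support (Finsupp.weight w)
        (support_nonempty.mpr hz)
      exact ih _ ⟨d, rfl⟩ (hg' d (mem_support_iff.mp hd)) g' fun e he =>
        hmax e (mem_support_iff.mpr he)
  by_cases hz : g = 0
  · exact hz ▸ h0
  · obtain ⟨d, hd, hmax⟩ := Finset.exists_max_image g.support (Finsupp.weight w)
      (support_nonempty.mpr hz)
    exact key _ ⟨d, rfl⟩ g fun e he => hmax e (mem_support_iff.mpr he)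

end Mul

end WeightFiltration

/-! ### Initial ideals, and when they commute with intersections and sums. -/

section InitialIdeal

variable {n : ℕ} {R : Type*} [CommRing R]
variable {Γ : Type*} [AddCommMonoid Γ] [LinearOrder Γ]
variable {w : Fin n → Γ} {γ δ : Γ} {g h : MvPolynomial (Fin n) R}
variable {I J : Ideal (MvPolynomial (Fin n) R)}

open Classical in
theorem coeff_initForm (d : Fin n →₀ ℕ) : coeff d (initForm w g) =
    if ∀ e, coeff e g ≠ 0 → Finsupp.weight w e ≤ Finsupp.weight w d then coeff d g else 0 := by
  classical
  simp only [initForm, coeff_sum, coeff_monomial, mem_support_iff]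
  rw [Finset.sum_ite_eq' _ d]
  simp only [Finset.mem_filter, mem_support_iff]
  by_cases h : coeff d g = 0 <;> simp [h]

theorem WeightLE.initForm_eq (hg : WeightLE w γ g)
    (hne : weightedHomogeneousComponent w γ g ≠ 0) :
    initForm w g = weightedHomogeneousComponent w γ g := by
  obtain ⟨e, he⟩ := ne_zero_iff.mp hne
  rw [coeff_weightedHomogeneousComponent] at he
  have heγ : Finsupp.weight w e = γ := by
    by_contra h
    exact he (if_neg h)
  rw [if_pos heγ] at he
  ext d
  rw [coeff_initForm, coeff_weightedHomogeneousComponent]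
  by_cases hd : Finsupp.weight w d = γ
  · rw [if_pos hd, if_pos fun e' he' => hd ▸ hg e' he']
  · rw [if_neg hd]
    split_ifs with hall
    · by_contra hcd
      exact hd (le_antisymm (hg d hcd) (heγ ▸ hall e he))
    · rfl

theorem exists_initForm_eq (w : Fin n → Γ) (g : MvPolynomial (Fin n) R) :
    ∃ γ, WeightLE w γ g ∧ initForm w g = weightedHomogeneousComponent w γ g := by
  by_cases hz : g = 0
  · refine ⟨0, hz ▸ weightLT_zero.weightLE, ?_⟩
    ext d
    simp [coeff_initForm, hz]
  · obtain ⟨d, hd, hmax⟩ := Finset.exists_max_image g.support (Finsupp.weight w)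
      (support_nonempty.mpr hz)
    have hle : WeightLE w (Finsupp.weight w d) g := fun e he => hmax e (mem_support_iff.mpr he)
    refine ⟨_, hle, hle.initForm_eq fun h0 => ?_⟩
    have := congrArg (coeff d) h0
    rw [coeff_weightedHomogeneousComponent, if_pos rfl, coeff_zero] at this
    exact mem_support_iff.mp hd this

theorem weightedHomogeneousComponent_mem_initIdeal (hgI : g ∈ I) (hg : WeightLE w γ g) :
    weightedHomogeneousComponent w γ g ∈ initIdeal w I := by
  by_cases h : weightedHomogeneousComponent w γ g = 0
  · rw [h]
    exact Ideal.zero_mem _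
  · rw [← hg.initForm_eq h]
    exact Ideal.subset_span ⟨g, hgI, rfl⟩

theorem initIdeal_le_iff : initIdeal w I ≤ J ↔
    ∀ g ∈ I, ∀ γ, WeightLE w γ g → weightedHomogeneousComponent w γ g ∈ J := by
  constructor
  · exact fun h g hgI γ hg => h (weightedHomogeneousComponent_mem_initIdeal hgI hg)
  · intro h
    refine Ideal.span_le.mpr ?_
    rintro _ ⟨g, hgI, rfl⟩
    obtain ⟨γ, hγ, heq⟩ := exists_initForm_eq w g
    rw [heq]
    exact h g hgI γ hγ

theorem initIdeal_mono (h : I ≤ J) : initIdeal w I ≤ initIdeal w J :=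
  Ideal.span_mono (Set.image_mono h)

variable [IsOrderedCancelAddMonoid Γ]

theorem weightLE_monomial (d : Fin n →₀ ℕ) (c : R) :
    WeightLE w (Finsupp.weight w d) (monomial d c) := by
  classical
  intro e he
  rw [coeff_monomial] at he
  by_cases h : d = e
  · rw [h]
  · simp [h] at he

theorem weightedHomogeneousComponent_monomial (d : Fin n →₀ ℕ) (c : R) :
    weightedHomogeneousComponent w (Finsupp.weight w d) (monomial d c) = monomial d c :=
  weightedHomogeneousComponent_eq_self (isWeightedHomogeneous_monomial _ _ _ rfl)

/-- Sums suffice because a monomial times a top component is the top component of a multiple in `I`.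
This lets additive maps such as the trace be checked on top components alone. -/
theorem mem_closure_of_mem_initIdeal {a : MvPolynomial (Fin n) R} (ha : a ∈ initIdeal w I) :
    a ∈ AddSubmonoid.closure
      {b | ∃ g ∈ I, ∃ γ, WeightLE w γ g ∧ weightedHomogeneousComponent w γ g = b} := by
  refine Submodule.span_induction ?_ (AddSubmonoid.zero_mem _)
    (fun _ _ _ _ => AddSubmonoid.add_mem _) ?_ ha
  · rintro _ ⟨g, hgI, rfl⟩
    obtain ⟨γ, hγ, heq⟩ := exists_initForm_eq w g
    exact AddSubmonoid.subset_closure ⟨g, hgI, γ, hγ, heq.symm⟩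
  · intro r x hx' hx
    rw [smul_eq_mul]
    clear hx'
    induction hx using AddSubmonoid.closure_induction with
    | zero =>
      rw [mul_zero]
      exact AddSubmonoid.zero_mem _
    | add x y _ _ hx hy =>
      rw [mul_add]
      exact AddSubmonoid.add_mem _ hx hy
    | mem x hx =>
      obtain ⟨g, hgI, γ, hγ, rfl⟩ := hx
      rw [r.as_sum, Finset.sum_mul]
      refine AddSubmonoid.sum_mem _ fun d _ => AddSubmonoid.subset_closure
        ⟨monomial d (coeff d r) * g, I.mul_mem_left _ hgI, Finsupp.weight w d + γ,
          (weightLE_monomial d _).mul hγ, ?_⟩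
      rw [(weightLE_monomial d _).weightedHomogeneousComponent_mul hγ,
        weightedHomogeneousComponent_monomial]

/-- The initial ideal is homogeneous: in a sum of top components only those of weight `γ` contribute
in weight `γ`, and the corresponding elements of `I` can be added up. -/
theorem exists_of_mem_initIdeal {a : MvPolynomial (Fin n) R} (ha : a ∈ initIdeal w I) (γ : Γ) :
    ∃ g ∈ I, WeightLE w γ g ∧
      weightedHomogeneousComponent w γ a = weightedHomogeneousComponent w γ g := by
  have ha' := mem_closure_of_mem_initIdeal ha
  clear ha
  induction ha' using AddSubmonoid.closure_induction with
  | zero => exact ⟨0, I.zero_mem, weightLT_zero.weightLE, rfl⟩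
  | add x y _ _ hx hy =>
    obtain ⟨g, hgI, hg, hxg⟩ := hx
    obtain ⟨h, hhI, hh, hyh⟩ := hy
    exact ⟨g + h, I.add_mem hgI hhI, hg.add hh, by rw [map_add, map_add, hxg, hyh]⟩
  | mem x hx =>
    obtain ⟨g, hgI, δ, hδ, rfl⟩ := hx
    by_cases h : γ = δ
    · subst h
      exact ⟨g, hgI, hδ, weightedHomogeneousComponent_self γ g⟩
    · exact ⟨0, I.zero_mem, weightLT_zero.weightLE, by
        rw [weightedHomogeneousComponent_of_ne h, map_zero]⟩

theorem weightedHomogeneousComponent_mem_initIdeal_of_mem {a : MvPolynomial (Fin n) R}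
    (ha : a ∈ initIdeal w I) (γ : Γ) : weightedHomogeneousComponent w γ a ∈ initIdeal w I := by
  obtain ⟨g, hgI, hg, heq⟩ := exists_of_mem_initIdeal ha γ
  rw [heq]
  exact weightedHomogeneousComponent_mem_initIdeal hgI hg

/-- Subtract from an element of `J` an element of `I` with the same leading part, and descend in the
weight. -/
theorem le_of_initIdeal_le (hw : ∀ i, 0 ≤ w i) (hIJ : I ≤ J)
    (h : initIdeal w J ≤ initIdeal w I) : J ≤ I := by
  intro g
  refine weight_induction hw (P := fun g => g ∈ J → g ∈ I) (fun _ => I.zero_mem) ?_ g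
  intro γ g hg ih hgJ
  obtain ⟨g', hg'I, hg', heq⟩ :=
    exists_of_mem_initIdeal (h (weightedHomogeneousComponent_mem_initIdeal hgJ hg)) γ
  rw [weightedHomogeneousComponent_self] at heq
  have := ih (g - g') (hg.weightLT_sub hg' heq) (J.sub_mem hgJ (hIJ hg'I))
  simpa using I.add_mem this hg'I

theorem initIdeal_mul_le : initIdeal w I * initIdeal w J ≤ initIdeal w (I * J) := by
  rw [initIdeal, initIdeal, Ideal.span_mul_span', Ideal.span_le]
  rintro _ ⟨_, ⟨g, hgI, rfl⟩, _, ⟨h, hhJ, rfl⟩, rfl⟩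
  obtain ⟨γ, hγ, hg⟩ := exists_initForm_eq w g
  obtain ⟨δ, hδ, hh⟩ := exists_initForm_eq w h
  simp only [hg, hh, ← hγ.weightedHomogeneousComponent_mul hδ]
  exact weightedHomogeneousComponent_mem_initIdeal (Ideal.mul_mem_mul hgI hhJ) (hγ.mul hδ)

theorem initIdeal_inf_of_isRadical (h : (initIdeal w (I ⊓ J)).IsRadical) :
    initIdeal w (I ⊓ J) = initIdeal w I ⊓ initIdeal w J := by
  refine le_antisymm (le_inf (initIdeal_mono inf_le_left) (initIdeal_mono inf_le_right)) ?_
  rintro a ⟨haI, haJ⟩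
  refine h ⟨2, ?_⟩
  rw [pow_two]
  exact initIdeal_mono Ideal.mul_le_inf (initIdeal_mul_le (Ideal.mul_mem_mul haI haJ))

/-- Induction on a weight bound for `a`. If the bound exceeds the weight of `a + b`, the leading
parts cancel, so they lie in both initial ideals and hence come from some `c ∈ I ⊓ J`. Replacing
`(a, b)` by `(a - c, b + c)` keeps the sum and lowers the weight. -/
theorem initIdeal_sup_of_initIdeal_inf (hw : ∀ i, 0 ≤ w i)
    (h : initIdeal w (I ⊓ J) = initIdeal w I ⊓ initIdeal w J) :
    initIdeal w (I ⊔ J) = initIdeal w I ⊔ initIdeal w J := by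
  refine le_antisymm ?_ (sup_le (initIdeal_mono le_sup_left) (initIdeal_mono le_sup_right))
  have key : ∀ a, a ∈ I → ∀ b ∈ J, ∀ γ, WeightLE w γ (a + b) →
      weightedHomogeneousComponent w γ (a + b) ∈ initIdeal w I ⊔ initIdeal w J := by
    intro a
    refine weight_induction hw (P := fun a => a ∈ I → ∀ b ∈ J, ∀ γ, WeightLE w γ (a + b) →
      weightedHomogeneousComponent w γ (a + b) ∈ initIdeal w I ⊔ initIdeal w J) ?_ ?_ a
    · intro _ b hb γ hγ
      rw [zero_add] at hγ ⊢
      exact Ideal.mem_sup_right (weightedHomogeneousComponent_mem_initIdeal hb hγ)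
    · intro δ a hδ ih ha b hb γ hγ
      rcases le_or_gt δ γ with hle | hlt
      · have haγ := hδ.mono hle
        have hbγ : WeightLE w γ b := by simpa using hγ.sub haγ
        rw [map_add]
        exact Ideal.add_mem _
          (Ideal.mem_sup_left (weightedHomogeneousComponent_mem_initIdeal ha haγ))
          (Ideal.mem_sup_right (weightedHomogeneousComponent_mem_initIdeal hb hbγ))
      · have hbδ : WeightLE w δ b := by simpa using (hγ.mono hlt.le).sub hδ
        have hzero := (hγ.mono hlt.le).weightLT_iff.mp (hγ.lt hlt)
        rw [map_add] at hzero
        have hmem : weightedHomogeneousComponent w δ a ∈ initIdeal w (I ⊓ J) := by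
          rw [h]
          refine ⟨weightedHomogeneousComponent_mem_initIdeal ha hδ, ?_⟩
          rw [eq_neg_of_add_eq_zero_left hzero]
          exact Ideal.neg_mem_iff _ |>.mpr (weightedHomogeneousComponent_mem_initIdeal hb hbδ)
        obtain ⟨c, ⟨hcI, hcJ⟩, hc, heq⟩ := exists_of_mem_initIdeal hmem δ
        rw [weightedHomogeneousComponent_self] at heq
        have hsum : a - c + (b + c) = a + b := by ring
        have := ih (a - c) (hδ.weightLT_sub hc heq) (I.sub_mem ha hcI) (b + c)
          (J.add_mem hb hcJ) γ (by rwa [hsum])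
        rwa [hsum] at this
  rw [initIdeal_le_iff]
  intro g hg γ hγ
  obtain ⟨a, ha, b, hb, rfl⟩ := Submodule.mem_sup.mp hg
  exact key a ha b hb γ hγ

/-- Top components commute with powers, so the initial ideal of the radical of `I` lies in the
radical of `initIdeal w I`. -/
theorem isRadical_of_initIdeal (hw : ∀ i, 0 ≤ w i) (h : (initIdeal w I).IsRadical) :
    I.IsRadical := by
  refine le_of_initIdeal_le (w := w) hw Ideal.le_radical ?_
  rw [initIdeal_le_iff]
  rintro g ⟨m, hm⟩ γ hγ
  refine h ⟨m, ?_⟩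
  rw [← hγ.weightedHomogeneousComponent_pow]
  exact weightedHomogeneousComponent_mem_initIdeal hm (hγ.pow m)

/-- The ideal `I ⊓ J` is contained in both and has the same initial ideal as each. -/
theorem eq_of_initIdeal_eq (hw : ∀ i, 0 ≤ w i) (h : initIdeal w I = initIdeal w J)
    (hinf : initIdeal w (I ⊓ J) = initIdeal w I ⊓ initIdeal w J) : I = J := by
  refine le_antisymm ?_ ?_
  · refine (le_of_initIdeal_le hw inf_le_left ?_).trans (inf_le_right : I ⊓ J ≤ J)
    rw [hinf, ← h, inf_idem]
  · refine (le_of_initIdeal_le hw inf_le_right ?_).trans (inf_le_left : I ⊓ J ≤ I)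
    rw [hinf, h, inf_idem]

theorem initIdeal_bot : initIdeal w (⊥ : Ideal (MvPolynomial (Fin n) R)) = ⊥ := by
  rw [eq_bot_iff, initIdeal_le_iff]
  intro g hg γ _
  rw [Ideal.mem_bot.mp hg, map_zero]
  exact Ideal.zero_mem _

end InitialIdeal

/-! ### Compatibly split ideals. -/

section CompatiblySplit

variable {R : Type*} [CommRing R] {φ : R → R} {p : ℕ} {I J : Ideal R}

/-- A splitting extracts `p`-th roots: `φ (r ^ p * 1) = r`. -/
theorem IsFrobeniusSplitting.isRadical (hφ : IsFrobeniusSplitting p φ) (hp : 1 < p)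
    (hI : IsCompatiblySplit φ I) : I.IsRadical := by
  refine (Ideal.isRadical_iff_pow_one_lt p hp).mpr fun r hr => ?_
  have := hI _ hr
  rwa [← mul_one (r ^ p), hφ.map_pow_mul, hφ.map_one, mul_one] at this

theorem IsCompatiblySplit.sup (hφ : ∀ a b, φ (a + b) = φ a + φ b) (hI : IsCompatiblySplit φ I)
    (hJ : IsCompatiblySplit φ J) : IsCompatiblySplit φ (I ⊔ J) := by
  intro a ha
  obtain ⟨b, hb, c, hc, rfl⟩ := Submodule.mem_sup.mp ha
  rw [hφ]
  exact Submodule.add_mem_sup (hI b hb) (hJ c hc)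

theorem IsCompatiblySplit.inf (hI : IsCompatiblySplit φ I) (hJ : IsCompatiblySplit φ J) :
    IsCompatiblySplit φ (I ⊓ J) :=
  fun a ha => ⟨hI a ha.1, hJ a ha.2⟩

end CompatiblySplit

/-! ### The trace on polynomials over `𝔽_p` and its effect on initial ideals. -/

section FrobTrace

variable {p n : ℕ}

/-- The exponent vector `p e + (p - 1, …, p - 1)`, whose monomial is sent to `x ^ e` by the
trace. -/
def traceExponent (p : ℕ) (e : Fin n →₀ ℕ) : Fin n →₀ ℕ :=
  p • e + Finsupp.equivFunOnFinite.symm fun _ => p - 1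

theorem traceExponent_apply (e : Fin n →₀ ℕ) (i : Fin n) :
    traceExponent p e i = p * e i + (p - 1) := by
  simp [traceExponent]

theorem coeff_frobTrace (hp : 0 < p) (e : Fin n →₀ ℕ) (u : MvPolynomial (Fin n) (ZMod p)) :
    coeff e (frobTrace p u) = coeff (traceExponent p e) u := by
  classical
  rw [frobTrace, coeff_sum]
  rw [Finset.sum_eq_single (traceExponent p e)]
  · rw [coeff_monomial, if_pos]
    ext i
    have h1 : p * e i + (p - 1) + 1 = p * (e i + 1) := by
      rw [mul_add]; omega
    simp [traceExponent_apply, h1, Nat.mul_div_cancel_left _ hp]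
  · intro d hd hne
    rw [coeff_monomial, if_neg]
    rintro rfl
    apply hne
    ext i
    obtain ⟨k, hk⟩ := (Finset.mem_filter.mp hd).2 i
    -- The quotient is at least `1`, so the truncated subtraction in `frobTrace` loses nothing.
    have hk0 : k ≠ 0 := by
      rintro rfl
      simp at hk
    obtain ⟨m, rfl⟩ := Nat.exists_eq_succ_of_ne_zero hk0
    rw [traceExponent_apply]
    simp only [Finsupp.equivFunOnFinite_symm_apply_apply, hk, Nat.mul_div_cancel_left _ hp]
    rw [Nat.succ_eq_add_one, mul_add] at hk
    simp only [Nat.succ_eq_add_one, Nat.add_sub_cancel]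
    omega
  · intro hd
    rw [coeff_monomial]
    split_ifs with h
    · by_contra hne
      refine hd (Finset.mem_filter.mpr ⟨mem_support_iff.mpr hne, fun i => ⟨e i + 1, ?_⟩⟩)
      rw [traceExponent_apply, mul_add]
      omega
    · rfl

theorem frobTrace_add (hp : 0 < p) (u v : MvPolynomial (Fin n) (ZMod p)) :
    frobTrace p (u + v) = frobTrace p u + frobTrace p v := by
  ext e
  simp [coeff_frobTrace hp]

theorem traceMap_add (hp : 0 < p) (f u v : MvPolynomial (Fin n) (ZMod p)) :
    traceMap p f (u + v) = traceMap p f u + traceMap p f v := by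
  rw [traceMap, mul_add, frobTrace_add hp, traceMap, traceMap]

theorem frobTrace_monomial_pow_mul [Fact p.Prime] (d : Fin n →₀ ℕ) (c : ZMod p)
    (u : MvPolynomial (Fin n) (ZMod p)) :
    frobTrace p (monomial d c ^ p * u) = monomial d c * frobTrace p u := by
  have hp : 0 < p := (Fact.out : p.Prime).pos
  ext e
  rw [coeff_frobTrace hp, monomial_pow, ZMod.pow_card, coeff_monomial_mul', coeff_monomial_mul',
    coeff_frobTrace hp]
  have hiff : p • d ≤ traceExponent p e ↔ d ≤ e := by
    refine forall_congr' fun i => ?_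
    rw [traceExponent_apply]
    simp only [Finsupp.smul_apply, smul_eq_mul]
    constructor
    · intro h
      by_contra hlt
      have : p * (e i + 1) ≤ p * d i := Nat.mul_le_mul_left p (by omega)
      rw [mul_add] at this
      omega
    · intro h
      have := Nat.mul_le_mul_left p h
      omega
  by_cases h : d ≤ e
  · rw [if_pos (hiff.mpr h), if_pos h]
    congr 2
    ext i
    have := Nat.mul_le_mul_left p (h i)
    simp only [Finsupp.tsub_apply, traceExponent_apply, Finsupp.smul_apply, smul_eq_mul,
      Nat.mul_sub]
    omega
  · rw [if_neg (mt hiff.mp h), if_neg h]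

theorem frobTrace_pow_mul [Fact p.Prime] (a u : MvPolynomial (Fin n) (ZMod p)) :
    frobTrace p (a ^ p * u) = a * frobTrace p u := by
  have hp : 0 < p := (Fact.out : p.Prime).pos
  induction a using MvPolynomial.induction_on' with
  | monomial d c => exact frobTrace_monomial_pow_mul d c u
  | add a b ha hb => rw [add_pow_char, add_mul, frobTrace_add hp, ha, hb, add_mul]

/-- The factor `(∏ x_i)^{p-1}` absorbs the shift by `p - 1` in `traceExponent`, leaving the map that
keeps the exponents divisible by `p` and divides them by `p`. -/
theorem coeff_traceMap_prod_X (hp : 0 < p) (e : Fin n →₀ ℕ)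
    (u : MvPolynomial (Fin n) (ZMod p)) :
    coeff e (traceMap p (∏ i, X i) u) = coeff (p • e) u := by
  have h1 : (∏ i, X i : MvPolynomial (Fin n) (ZMod p)) ^ (p - 1) =
      monomial (Finsupp.equivFunOnFinite.symm fun _ => p - 1) 1 := by
    rw [monomial_eq, C_1, one_mul, Finsupp.prod_fintype _ _ (fun i => pow_zero _),
      ← Finset.prod_pow]
    rfl
  rw [traceMap, coeff_frobTrace hp, h1, traceExponent, add_comm, coeff_monomial_mul, one_mul]

theorem isFrobeniusSplitting_traceMap_prod_X [Fact p.Prime] :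
    IsFrobeniusSplitting p (traceMap p (∏ i, X i : MvPolynomial (Fin n) (ZMod p))) where
  map_add := traceMap_add (Fact.out : p.Prime).pos _
  map_pow_mul a b := by
    rw [traceMap, mul_left_comm, frobTrace_pow_mul, traceMap]
  map_one := by
    classical
    have hp := (Fact.out : p.Prime).pos
    ext e
    rw [coeff_traceMap_prod_X hp, coeff_one, coeff_one]
    congr 1
    simp [eq_comm (a := (0 : Fin n →₀ ℕ)), hp.ne']

variable {Γ : Type*} [AddCommMonoid Γ] [LinearOrder Γ] [IsOrderedCancelAddMonoid Γ]
variable {w : Fin n → Γ} {γ δ : Γ}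

theorem weight_traceExponent_le_iff (hp : 0 < p) (d e : Fin n →₀ ℕ) :
    Finsupp.weight w (traceExponent p d) ≤ Finsupp.weight w (traceExponent p e) ↔
      Finsupp.weight w d ≤ Finsupp.weight w e := by
  simp only [traceExponent, map_add, map_nsmul, add_le_add_iff_right]
  exact (nsmul_right_strictMono hp.ne').le_iff_le

/-- The weight of `traceExponent p e` increases strictly with that of `e`. Hence the trace of a top
component is zero or the top component of the trace. -/
theorem frobTrace_weightedHomogeneousComponent_mem_initIdeal (hp : 0 < p)
    {I : Ideal (MvPolynomial (Fin n) (ZMod p))} {u : MvPolynomial (Fin n) (ZMod p)}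
    (hu : WeightLE w γ u) (huI : frobTrace p u ∈ I) :
    frobTrace p (weightedHomogeneousComponent w γ u) ∈ initIdeal w I := by
  by_cases hz : frobTrace p (weightedHomogeneousComponent w γ u) = 0
  · rw [hz]
    exact Ideal.zero_mem _
  obtain ⟨e, he⟩ := ne_zero_iff.mp hz
  rw [coeff_frobTrace hp, coeff_weightedHomogeneousComponent] at he
  have heγ : Finsupp.weight w (traceExponent p e) = γ := by
    by_contra h
    exact he (if_neg h)
  have hle : WeightLE w (Finsupp.weight w e) (frobTrace p u) := by
    intro d hd
    rw [coeff_frobTrace hp] at hd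
    rw [← weight_traceExponent_le_iff hp, heγ]
    exact hu _ hd
  have heq : frobTrace p (weightedHomogeneousComponent w γ u) =
      weightedHomogeneousComponent w (Finsupp.weight w e) (frobTrace p u) := by
    ext d
    rw [coeff_frobTrace hp, coeff_weightedHomogeneousComponent,
      coeff_weightedHomogeneousComponent, coeff_frobTrace hp, ← heγ]
    simp only [le_antisymm_iff, weight_traceExponent_le_iff hp]
  rw [heq]
  exact weightedHomogeneousComponent_mem_initIdeal huI hle

theorem IsCompatiblySplit.initIdeal (hp : 0 < p) {I : Ideal (MvPolynomial (Fin n) (ZMod p))}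
    {f : MvPolynomial (Fin n) (ZMod p)} (hf : WeightLE w γ f)
    (hI : IsCompatiblySplit (traceMap p f) I) :
    IsCompatiblySplit (traceMap p (weightedHomogeneousComponent w γ f)) (initIdeal w I) := by
  intro a ha
  have ha' := mem_closure_of_mem_initIdeal ha
  clear ha
  induction ha' using AddSubmonoid.closure_induction with
  | zero =>
    have h0 : frobTrace p (0 : MvPolynomial (Fin n) (ZMod p)) = 0 := by
      ext e
      simp [coeff_frobTrace hp]
    rw [traceMap, mul_zero, h0]
    exact Ideal.zero_mem _
  | add x y _ _ hx hy =>
    rw [traceMap_add hp]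
    exact Ideal.add_mem _ hx hy
  | mem x hx =>
    obtain ⟨g, hgI, δ, hδ, rfl⟩ := hx
    rw [traceMap, ← hf.weightedHomogeneousComponent_pow,
      ← (hf.pow _).weightedHomogeneousComponent_mul hδ]
    exact frobTrace_weightedHomogeneousComponent_mem_initIdeal hp ((hf.pow _).mul hδ) (hI g hgI)

/-- A monomial multiplier can be chosen so that the splitting isolates the single term of exponent
`e` and returns its squarefree radical. The bound on exponents excludes all other terms. -/
theorem prod_X_mem_of_isCompatiblySplit [Fact p.Prime]
    {J : Ideal (MvPolynomial (Fin n) (ZMod p))}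
    (hJ : IsCompatiblySplit (traceMap p (∏ i, X i)) J) {a : MvPolynomial (Fin n) (ZMod p)}
    (ha : a ∈ J) (hbound : ∀ d, coeff d a ≠ 0 → ∀ i, d i < p) {e : Fin n →₀ ℕ}
    (he : coeff e a ≠ 0) : ∏ i ∈ e.support, X i ∈ J := by
  classical
  have hp : 0 < p := (Fact.out : p.Prime).pos
  -- Chosen so that `b + e = p • s`. If `b + d = p • c` with all `d i < p`, then `c i = 1` where `e
  -- i ≠ 0` and `c i = 0` elsewhere, so `c = s` and `d = e`.
  set b : Fin n →₀ ℕ := Finsupp.equivFunOnFinite.symm fun i => if e i = 0 then 0 else p - e i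
    with hb
  set s : Fin n →₀ ℕ := Finsupp.equivFunOnFinite.symm fun i => if e i = 0 then 0 else 1 with hs
  have hprod : (∏ i ∈ e.support, X i : MvPolynomial (Fin n) (ZMod p)) = monomial s 1 := by
    rw [monomial_eq, C_1, one_mul, Finsupp.prod_fintype _ _ (fun i => pow_zero _),
      ← Finset.prod_subset (Finset.subset_univ e.support)]
    · refine Finset.prod_congr rfl fun i hi => ?_
      simp [hs, Finsupp.mem_support_iff.mp hi]
    · intro i _ hi
      simp [hs, Finsupp.notMem_support_iff.mp hi]
  have key : traceMap p (∏ i, X i) (monomial b 1 * a) = monomial s (coeff e a) := by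
    ext c
    rw [coeff_traceMap_prod_X hp, coeff_monomial_mul', coeff_monomial, one_mul]
    by_cases hsc : s = c
    · subst hsc
      have h1 : p • s = b + e := by
        ext i
        have := hbound e he i
        by_cases hi : e i = 0 <;> simp [hs, hb, hi]
        omega
      rw [if_pos rfl, h1, if_pos (by simp), add_tsub_cancel_left]
    · rw [if_neg hsc]
      split_ifs with hle
      · by_contra hne
        apply hsc
        ext i
        have h1 := hbound _ hne i
        have h2 := hle i
        have h3 := hbound e he i
        simp only [Finsupp.tsub_apply, Finsupp.smul_apply, smul_eq_mul] at h1 h2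
        by_cases hi : e i = 0
        · simp only [hb, hs, Finsupp.equivFunOnFinite_symm_apply_apply, hi, if_true] at h1 h2 ⊢
          rcases Nat.eq_zero_or_pos (c i) with h | h
          · exact h.symm
          · have := Nat.mul_le_mul_left p h
            omega
        · simp only [hb, hs, Finsupp.equivFunOnFinite_symm_apply_apply, hi, if_false] at h1 h2 ⊢
          rcases lt_trichotomy (c i) 1 with h | h | h
          · have h0 : c i = 0 := by omega
            rw [h0] at h2
            omega
          · exact h.symm
          · have := Nat.mul_le_mul_left p (show 2 ≤ c i from h)
            omega
      · rfl
  have hmem := hJ _ (J.mul_mem_left (monomial b 1) ha)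
  rw [key] at hmem
  have := J.mul_mem_left (C (coeff e a)⁻¹) hmem
  rwa [C_mul_monomial, inv_mul_cancel₀ he, ← hprod] at this

end FrobTrace

/-! ### Reduction modulo almost all primes. -/

section Reduction

open Filter

variable {n : ℕ}

theorem isUnit_natCast_mvPolynomial {K : Type*} [Field K] {N : ℕ} (hN : (N : K) ≠ 0) :
    IsUnit (N : MvPolynomial (Fin n) K) := by
  have := (IsUnit.mk0 _ hN).map (C : K →+* MvPolynomial (Fin n) K)
  rwa [map_natCast] at this

theorem mem_of_natCast_mul_mem {K : Type*} [Field K] {I : Ideal (MvPolynomial (Fin n) K)}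
    {N : ℕ} (hN : (N : K) ≠ 0) {a : MvPolynomial (Fin n) K}
    (h : (N : MvPolynomial (Fin n) K) * a ∈ I) :
    a ∈ I :=
  (Ideal.unit_mul_mem_iff_mem I (isUnit_natCast_mvPolynomial hN)).mp h

theorem map_intCast_injective :
    Function.Injective (MvPolynomial.map (σ := Fin n) (Int.castRingHom ℚ)) :=
  map_injective _ (Int.castRingHom ℚ).injective_int

theorem exists_natCast_mul_eq_map (q : MvPolynomial (Fin n) ℚ) :
    ∃ N : ℕ, N ≠ 0 ∧ ∃ z : MvPolynomial (Fin n) ℤ,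
      MvPolynomial.map (Int.castRingHom ℚ) z = (N : MvPolynomial (Fin n) ℚ) * q := by
  induction q using MvPolynomial.induction_on' with
  | monomial d c =>
    refine ⟨c.den, c.den_nz, monomial d c.num, ?_⟩
    rw [map_monomial, ← nsmul_eq_mul, smul_monomial, nsmul_eq_mul, Rat.den_mul_eq_num]
    rfl
  | add a b ha hb =>
    obtain ⟨N, hN, z, hz⟩ := ha
    obtain ⟨N', hN', z', hz'⟩ := hb
    refine ⟨N * N', mul_ne_zero hN hN', (N' : MvPolynomial (Fin n) ℤ) * z + N * z', ?_⟩
    rw [map_add, map_mul, map_mul, hz, hz', map_natCast, map_natCast]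
    push_cast
    ring

theorem exists_natCast_mul_mem_of_map_mem {𝔞 : Ideal (MvPolynomial (Fin n) ℤ)}
    {q : MvPolynomial (Fin n) ℚ} (hq : q ∈ 𝔞.map (MvPolynomial.map (Int.castRingHom ℚ))) :
    ∃ N : ℕ, N ≠ 0 ∧ ∃ z ∈ 𝔞,
      MvPolynomial.map (Int.castRingHom ℚ) z = (N : MvPolynomial (Fin n) ℚ) * q := by
  refine Submodule.span_induction ?_ ⟨1, one_ne_zero, 0, 𝔞.zero_mem, by simp⟩ ?_ ?_ hq
  · rintro _ ⟨z, hz, rfl⟩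
    exact ⟨1, one_ne_zero, z, hz, by simp⟩
  · rintro x y _ _ ⟨N, hN, z, hza, hz⟩ ⟨N', hN', z', hza', hz'⟩
    refine ⟨N * N', mul_ne_zero hN hN', (N' : MvPolynomial (Fin n) ℤ) * z + N * z',
      𝔞.add_mem (𝔞.mul_mem_left _ hza) (𝔞.mul_mem_left _ hza'), ?_⟩
    rw [map_add, map_mul, map_mul, hz, hz', map_natCast, map_natCast]
    push_cast
    ring
  · rintro r x _ ⟨N, hN, z, hza, hz⟩
    obtain ⟨N', hN', z', hz'⟩ := exists_natCast_mul_eq_map r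
    refine ⟨N * N', mul_ne_zero hN hN', z' * z, 𝔞.mul_mem_left _ hza, ?_⟩
    rw [map_mul, hz, hz', smul_eq_mul]
    push_cast
    ring

/-- Denominators of the integral elements of an ideal with respect to integral generators are
bounded. -/
theorem exists_natCast_mul_mem_of_le_map {𝔞 : Ideal (MvPolynomial (Fin n) ℤ)}
    {J : Ideal (MvPolynomial (Fin n) ℚ)}
    (hJ : J ≤ 𝔞.map (MvPolynomial.map (Int.castRingHom ℚ))) :
    ∃ N : ℕ, N ≠ 0 ∧ ∀ h, MvPolynomial.map (Int.castRingHom ℚ) h ∈ J →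
      (N : MvPolynomial (Fin n) ℤ) * h ∈ 𝔞 := by
  have key : ∀ h ∈ J.comap (MvPolynomial.map (Int.castRingHom ℚ)),
      ∃ N : ℕ, N ≠ 0 ∧ (N : MvPolynomial (Fin n) ℤ) * h ∈ 𝔞 := by
    intro h hh
    obtain ⟨N, hN, z, hza, hz⟩ := exists_natCast_mul_mem_of_map_mem (hJ hh)
    refine ⟨N, hN, ?_⟩
    rw [← map_natCast (MvPolynomial.map (Int.castRingHom ℚ)), ← map_mul] at hz
    rwa [← map_intCast_injective hz]
  -- One denominator works for all elements: multiply those of finitely many generators.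
  obtain ⟨S, hS⟩ := (isNoetherianRing_iff_ideal_fg _).mp inferInstance
    (J.comap (MvPolynomial.map (Int.castRingHom ℚ)))
  choose! N hN hNmem using key
  refine ⟨∏ s ∈ S, N s, Finset.prod_ne_zero_iff.mpr fun s hs =>
    hN s (hS ▸ Ideal.subset_span hs), fun h hh => ?_⟩
  have hh' : h ∈ Ideal.span (S : Set (MvPolynomial (Fin n) ℤ)) := hS ▸ hh
  refine Submodule.span_induction ?_ (by simp) ?_ ?_ hh'
  · intro s hs
    obtain ⟨k, hk⟩ := Finset.dvd_prod_of_mem N hs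
    rw [hk, mul_comm (N s) k]
    push_cast
    rw [mul_assoc]
    exact 𝔞.mul_mem_left _ (hNmem s (hS ▸ Ideal.subset_span hs))
  · intro x y _ _ hx hy
    rw [mul_add]
    exact 𝔞.add_mem hx hy
  · intro r x _ hx
    rw [smul_eq_mul, mul_left_comm]
    exact 𝔞.mul_mem_left _ hx

theorem eventually_not_dvd {N : ℕ} (hN : N ≠ 0) : ∀ᶠ p : ℕ in cofinite, ¬ p ∣ N := by
  rw [eventually_cofinite]
  refine (Set.finite_Iic N).subset fun p hp => ?_
  exact Nat.le_of_dvd (Nat.pos_of_ne_zero hN) (not_not.mp hp)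

theorem natCast_zmod_ne_zero {p N : ℕ} (h : ¬ p ∣ N) : (N : ZMod p) ≠ 0 :=
  mt (ZMod.natCast_eq_zero_iff N p).mp h

theorem mem_reduceIdeal {p : ℕ} {I : Ideal (MvPolynomial (Fin n) ℚ)}
    {a : MvPolynomial (Fin n) (ZMod p)} : a ∈ reduceIdeal p I ↔
      ∃ h, MvPolynomial.map (Int.castRingHom ℚ) h ∈ I ∧ reducePoly p h = a :=
  Ideal.mem_map_iff_of_surjective _ (map_surjective _ (ZMod.ringHom_surjective _))

theorem reducePoly_mem_reduceIdeal {p : ℕ} {I : Ideal (MvPolynomial (Fin n) ℚ)}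
    {h : MvPolynomial (Fin n) ℤ} (hh : MvPolynomial.map (Int.castRingHom ℚ) h ∈ I) :
    reducePoly p h ∈ reduceIdeal p I :=
  mem_reduceIdeal.mpr ⟨h, hh, rfl⟩

theorem exists_eq_natCast_mul_of_reducePoly_eq_zero {p : ℕ} {h : MvPolynomial (Fin n) ℤ}
    (hh : reducePoly p h = 0) : ∃ u, h = (p : MvPolynomial (Fin n) ℤ) * u := by
  obtain ⟨u, hu⟩ := (C_dvd_iff_zmod p h).mpr hh
  exact ⟨u, by rw [hu]; simp⟩

theorem reducePoly_natCast_mul (p N : ℕ) (h : MvPolynomial (Fin n) ℤ) :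
    reducePoly p ((N : MvPolynomial (Fin n) ℤ) * h) =
      (N : MvPolynomial (Fin n) (ZMod p)) * reducePoly p h := by
  rw [reducePoly, map_mul, map_natCast, reducePoly]

theorem reducePoly_self_mul (p : ℕ) (h : MvPolynomial (Fin n) ℤ) :
    reducePoly p ((p : MvPolynomial (Fin n) ℤ) * h) = 0 := by
  rw [reducePoly_natCast_mul, CharP.cast_eq_zero, zero_mul]

theorem reducePoly_sub (p : ℕ) (h h' : MvPolynomial (Fin n) ℤ) :
    reducePoly p (h - h') = reducePoly p h - reducePoly p h' :=
  map_sub _ _ _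

theorem map_comap_intCast (I : Ideal (MvPolynomial (Fin n) ℚ)) :
    (I.comap (MvPolynomial.map (Int.castRingHom ℚ))).map
      (MvPolynomial.map (Int.castRingHom ℚ)) = I := by
  refine le_antisymm Ideal.map_comap_le fun q hq => ?_
  obtain ⟨N, hN, z, hz⟩ := exists_natCast_mul_eq_map q
  refine mem_of_natCast_mul_mem (N := N) (by exact_mod_cast hN) ?_
  rw [← hz]
  refine Ideal.mem_map_of_mem _ ?_
  rw [Ideal.mem_comap, hz]
  exact I.mul_mem_left _ hq

/-- The contraction to `ℤ[x]` of the extension of `𝔞` exceeds `𝔞` only by a bounded denominator `N`,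
which is a unit mod `p` when `p ∤ N`. -/
theorem eventually_reduceIdeal_map (𝔞 : Ideal (MvPolynomial (Fin n) ℤ)) :
    ∀ᶠ p : ℕ in cofinite, p.Prime →
      reduceIdeal p (𝔞.map (MvPolynomial.map (Int.castRingHom ℚ))) =
        𝔞.map (MvPolynomial.map (Int.castRingHom (ZMod p))) := by
  obtain ⟨N, hN, hNmem⟩ := exists_natCast_mul_mem_of_le_map (𝔞 := 𝔞) le_rfl
  filter_upwards [eventually_not_dvd hN] with p hpN hp
  have := Fact.mk hp
  refine le_antisymm (fun a ha => ?_) (Ideal.map_mono Ideal.le_comap_map)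
  obtain ⟨h, hh, rfl⟩ := mem_reduceIdeal.mp ha
  refine mem_of_natCast_mul_mem (natCast_zmod_ne_zero hpN) ?_
  rw [← reducePoly_natCast_mul]
  exact Ideal.mem_map_of_mem _ (hNmem h hh)

theorem eventually_reduceIdeal_sup (I J : Ideal (MvPolynomial (Fin n) ℚ)) :
    ∀ᶠ p : ℕ in cofinite, p.Prime →
      reduceIdeal p (I ⊔ J) = reduceIdeal p I ⊔ reduceIdeal p J := by
  have := eventually_reduceIdeal_map (I.comap (MvPolynomial.map (Int.castRingHom ℚ)) ⊔
    J.comap (MvPolynomial.map (Int.castRingHom ℚ)))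
  rw [Ideal.map_sup, map_comap_intCast, map_comap_intCast] at this
  filter_upwards [this] with p h hp
  rw [h hp, Ideal.map_sup, reduceIdeal, reduceIdeal]

/-- If `i ∈ I` and `j ∈ J` agree mod `p`, then `i - j = p u` with `u ∈ I ⊔ J`, and `N u = i' + j'`
integrally. So `N i - p i' = N j + p j'` lies in both ideals and reduces to a unit multiple of `i`.
-/
theorem eventually_reduceIdeal_inf (I J : Ideal (MvPolynomial (Fin n) ℚ)) :
    ∀ᶠ p : ℕ in cofinite, p.Prime →
      reduceIdeal p (I ⊓ J) = reduceIdeal p I ⊓ reduceIdeal p J := by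
  have hle : I ⊔ J ≤ (I.comap (MvPolynomial.map (Int.castRingHom ℚ)) ⊔
      J.comap (MvPolynomial.map (Int.castRingHom ℚ))).map
        (MvPolynomial.map (Int.castRingHom ℚ)) := by
    rw [Ideal.map_sup, map_comap_intCast, map_comap_intCast]
  obtain ⟨N, hN, hNmem⟩ := exists_natCast_mul_mem_of_le_map hle
  filter_upwards [eventually_not_dvd hN] with p hpN hp
  have := Fact.mk hp
  refine le_antisymm (le_inf (Ideal.map_mono (Ideal.comap_mono inf_le_left))
    (Ideal.map_mono (Ideal.comap_mono inf_le_right))) ?_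
  rintro a ⟨haI, haJ⟩
  obtain ⟨i, hi, rfl⟩ := mem_reduceIdeal.mp haI
  obtain ⟨j, hj, hij⟩ := mem_reduceIdeal.mp haJ
  obtain ⟨u, hu⟩ := exists_eq_natCast_mul_of_reducePoly_eq_zero (p := p) (h := i - j)
    (by rw [reducePoly_sub, hij, sub_self])
  have huQ : MvPolynomial.map (Int.castRingHom ℚ) u ∈ I ⊔ J := by
    refine mem_of_natCast_mul_mem (N := p) (by exact_mod_cast hp.ne_zero) ?_
    have := congrArg (MvPolynomial.map (Int.castRingHom ℚ)) hu
    rw [map_mul, map_natCast, map_sub] at this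
    rw [← this]
    exact Ideal.sub_mem _ (Ideal.mem_sup_left hi) (Ideal.mem_sup_right hj)
  obtain ⟨i', hi', j', hj', hsum⟩ := Submodule.mem_sup.mp (hNmem u huQ)
  refine mem_of_natCast_mul_mem (natCast_zmod_ne_zero hpN) ?_
  have hred : reducePoly p ((N : MvPolynomial (Fin n) ℤ) * i - (p : MvPolynomial (Fin n) ℤ) * i') =
      (N : MvPolynomial (Fin n) (ZMod p)) * reducePoly p i := by
    rw [reducePoly_sub, reducePoly_self_mul, sub_zero, reducePoly_natCast_mul]
  rw [← hred]
  refine reducePoly_mem_reduceIdeal ⟨?_, ?_⟩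
  · exact (I.comap (MvPolynomial.map (Int.castRingHom ℚ))).sub_mem
      (Ideal.mul_mem_left _ _ hi) (Ideal.mul_mem_left _ _ hi')
  · have heq : (N : MvPolynomial (Fin n) ℤ) * i - p * i' = N * j + p * j' := by
      linear_combination (N : MvPolynomial (Fin n) ℤ) * hu - (p : MvPolynomial (Fin n) ℤ) * hsum
    rw [heq]
    exact (J.comap (MvPolynomial.map (Int.castRingHom ℚ))).add_mem
      (Ideal.mul_mem_left _ _ hj) (Ideal.mul_mem_left _ _ hj')

variable {Γ : Type*} [AddCommMonoid Γ] [LinearOrder Γ] [IsOrderedCancelAddMonoid Γ]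
variable {w : Fin n → Γ}

theorem map_initIdeal_le {R S : Type*} [CommRing R] [CommRing S] (φ : R →+* S)
    (𝔞 : Ideal (MvPolynomial (Fin n) R)) :
    (initIdeal w 𝔞).map (MvPolynomial.map φ) ≤ initIdeal w (𝔞.map (MvPolynomial.map φ)) := by
  rw [Ideal.map_le_iff_le_comap, initIdeal_le_iff]
  intro g hg γ hγ
  rw [Ideal.mem_comap, map_weightedHomogeneousComponent]
  exact weightedHomogeneousComponent_mem_initIdeal (Ideal.mem_map_of_mem _ hg) (hγ.map φ)

theorem initIdeal_eq_map (I : Ideal (MvPolynomial (Fin n) ℚ)) :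
    initIdeal w I = (initIdeal w (I.comap (MvPolynomial.map (Int.castRingHom ℚ)))).map
      (MvPolynomial.map (Int.castRingHom ℚ)) := by
  refine le_antisymm ?_ ((map_initIdeal_le _ _).trans (initIdeal_mono Ideal.map_comap_le))
  rw [initIdeal_le_iff]
  intro g hg γ hγ
  obtain ⟨N, hN, z, hz⟩ := exists_natCast_mul_eq_map g
  have hzγ : WeightLE w γ z := by
    intro d hd
    refine hγ d fun h0 => hd ?_
    have := congrArg (coeff d) hz
    rw [coeff_map, ← nsmul_eq_mul, coeff_smul, h0, smul_zero] at this
    simpa using this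
  refine mem_of_natCast_mul_mem (N := N) (by exact_mod_cast hN) ?_
  rw [← weightedHomogeneousComponent_natCast_mul, ← hz, ← map_weightedHomogeneousComponent]
  refine Ideal.mem_map_of_mem _ (weightedHomogeneousComponent_mem_initIdeal ?_ hzγ)
  rw [Ideal.mem_comap, hz]
  exact I.mul_mem_left _ hg

/-- The obstacle is a leading part that vanishes mod `p`. It is then `p u` with `u` in the initial
ideal over `ℚ`, and `N u` agrees in that weight with the leading part of some integral `g` in the
ideal. Passing to `N h - p g` lowers the weight and changes the reduction only by the unit `N`. -/
theorem eventually_initIdeal_reduceIdeal (hw : ∀ i, 0 ≤ w i)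
    (I : Ideal (MvPolynomial (Fin n) ℚ)) :
    ∀ᶠ p : ℕ in cofinite, p.Prime →
      reduceIdeal p (initIdeal w I) = initIdeal w (reduceIdeal p I) := by
  set 𝔞 := I.comap (MvPolynomial.map (Int.castRingHom ℚ)) with h𝔞
  obtain ⟨N, hN, hNmem⟩ := exists_natCast_mul_mem_of_le_map (initIdeal_eq_map (w := w) I).le
  have hmap := eventually_reduceIdeal_map (initIdeal w 𝔞)
  rw [← initIdeal_eq_map] at hmap
  filter_upwards [eventually_not_dvd hN, hmap] with p hpN hmap hp
  have := Fact.mk hp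
  rw [hmap hp]
  refine le_antisymm (map_initIdeal_le _ _) ?_
  have key : ∀ h : MvPolynomial (Fin n) ℤ, h ∈ 𝔞 → ∀ γ, WeightLE w γ (reducePoly p h) →
      weightedHomogeneousComponent w γ (reducePoly p h) ∈
        (initIdeal w 𝔞).map (MvPolynomial.map (Int.castRingHom (ZMod p))) := by
    intro h
    refine weight_induction hw (P := fun h => h ∈ 𝔞 → ∀ γ, WeightLE w γ (reducePoly p h) →
      weightedHomogeneousComponent w γ (reducePoly p h) ∈
        (initIdeal w 𝔞).map (MvPolynomial.map (Int.castRingHom (ZMod p)))) ?_ ?_ h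
    · intro _ γ _
      rw [reducePoly, map_zero, map_zero]
      exact Ideal.zero_mem _
    · intro δ h hδ ih hh γ hγ
      rcases le_or_gt δ γ with hle | hlt
      · rw [reducePoly, ← map_weightedHomogeneousComponent]
        exact Ideal.mem_map_of_mem _
          (weightedHomogeneousComponent_mem_initIdeal hh (hδ.mono hle))
      · have hz : reducePoly p (weightedHomogeneousComponent w δ h) = 0 := by
          rw [reducePoly, map_weightedHomogeneousComponent]
          exact (hγ.mono hlt.le).weightLT_iff.mp (hγ.lt hlt)
        obtain ⟨u, hu⟩ := exists_eq_natCast_mul_of_reducePoly_eq_zero hz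
        have huQ : MvPolynomial.map (Int.castRingHom ℚ) u ∈ initIdeal w I := by
          refine mem_of_natCast_mul_mem (N := p) (by exact_mod_cast hp.ne_zero) ?_
          rw [← map_natCast (MvPolynomial.map (Int.castRingHom ℚ)), ← map_mul, ← hu,
            map_weightedHomogeneousComponent]
          exact weightedHomogeneousComponent_mem_initIdeal hh (hδ.map _)
        obtain ⟨g, hg𝔞, hg, heq⟩ := exists_of_mem_initIdeal (hNmem u huQ) δ
        have hh' : WeightLE w δ ((N : MvPolynomial (Fin n) ℤ) * h) := by
          simpa using hδ.C_mul (N : ℤ)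
        have hg' : WeightLE w δ ((p : MvPolynomial (Fin n) ℤ) * g) := by
          simpa using hg.C_mul (p : ℤ)
        have hcomp : weightedHomogeneousComponent w δ ((N : MvPolynomial (Fin n) ℤ) * h) =
            weightedHomogeneousComponent w δ ((p : MvPolynomial (Fin n) ℤ) * g) := by
          rw [weightedHomogeneousComponent_natCast_mul, weightedHomogeneousComponent_natCast_mul,
            ← heq, weightedHomogeneousComponent_natCast_mul, mul_left_comm,
            ← weightedHomogeneousComponent_natCast_mul p, ← hu, weightedHomogeneousComponent_self]
        have hred : reducePoly p ((N : MvPolynomial (Fin n) ℤ) * h - (p : MvPolynomial (Fin n) ℤ) * g) =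
            (N : MvPolynomial (Fin n) (ZMod p)) * reducePoly p h := by
          rw [reducePoly_sub, reducePoly_self_mul, sub_zero, reducePoly_natCast_mul]
        have hmem := ih _ (hh'.weightLT_sub hg' hcomp)
          (𝔞.sub_mem (𝔞.mul_mem_left _ hh) (𝔞.mul_mem_left _ hg𝔞)) γ
          (by rw [hred]; simpa using hγ.C_mul (N : ZMod p))
        rw [hred, weightedHomogeneousComponent_natCast_mul] at hmem
        exact mem_of_natCast_mul_mem (natCast_zmod_ne_zero hpN) hmem
  rw [initIdeal_le_iff]
  intro g hg γ hγ
  obtain ⟨h, hh, rfl⟩ := mem_reduceIdeal.mp hg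
  exact key h hh γ hγ

theorem weightedHomogeneousComponent_eq_monomial {R : Type*} [CommRing R]
    (hinj : Function.Injective (Finsupp.weight w : (Fin n →₀ ℕ) → Γ)) (e : Fin n →₀ ℕ)
    (g : MvPolynomial (Fin n) R) :
    weightedHomogeneousComponent w (Finsupp.weight w e) g = monomial e (coeff e g) := by
  ext d
  rw [coeff_weightedHomogeneousComponent, coeff_monomial]
  simp only [hinj.eq_iff, eq_comm (a := d)]
  split_ifs with h
  · rw [h]
  · rfl

/-- Division with respect to a term order: one suitable prime shows that the leading term of `r`
lies in the initial ideal over `ℚ`. Subtracting an element of `J` then lowers the weight while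
keeping membership modulo infinitely many primes. -/
theorem map_mem_of_frequently_of_injective (hw : ∀ i, 0 ≤ w i)
    (hinj : Function.Injective (Finsupp.weight w : (Fin n →₀ ℕ) → Γ))
    (J : Ideal (MvPolynomial (Fin n) ℚ)) (r : MvPolynomial (Fin n) ℤ) :
    (∃ᶠ p : ℕ in cofinite, p.Prime ∧ reducePoly p r ∈ reduceIdeal p J) →
      MvPolynomial.map (Int.castRingHom ℚ) r ∈ J := by
  set 𝔞 := J.comap (MvPolynomial.map (Int.castRingHom ℚ)) with h𝔞
  obtain ⟨N, hN, hNmem⟩ := exists_natCast_mul_mem_of_le_map (initIdeal_eq_map (w := w) J).le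
  have hNQ : (N : ℚ) ≠ 0 := by exact_mod_cast hN
  refine weight_induction hw (P := fun r => (∃ᶠ p : ℕ in cofinite, p.Prime ∧
    reducePoly p r ∈ reduceIdeal p J) → MvPolynomial.map (Int.castRingHom ℚ) r ∈ J) ?_ ?_ r
  · intro _
    rw [map_zero]
    exact J.zero_mem
  intro δ r hδ ih hfreq
  have hlead : MvPolynomial.map (Int.castRingHom ℚ) (weightedHomogeneousComponent w δ r) ∈
      initIdeal w J := by
    by_cases hz : weightedHomogeneousComponent w δ r = 0
    · rw [hz, map_zero]
      exact Ideal.zero_mem _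
    obtain ⟨e, he⟩ := ne_zero_iff.mp hz
    rw [coeff_weightedHomogeneousComponent] at he
    have heδ : Finsupp.weight w e = δ := by
      by_contra h
      exact he (if_neg h)
    rw [if_pos heδ] at he
    subst heδ
    have hmap := eventually_reduceIdeal_map (initIdeal w 𝔞)
    rw [← initIdeal_eq_map] at hmap
    obtain ⟨p, ⟨hp, hpr⟩, hinit, hmap, hdvd⟩ := (hfreq.and_eventually
      ((eventually_initIdeal_reduceIdeal hw J).and (hmap.and
        (eventually_not_dvd (Int.natAbs_ne_zero.mpr he))))).exists
    have hmem := weightedHomogeneousComponent_mem_initIdeal hpr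
      (hδ.map (Int.castRingHom (ZMod p)))
    rw [← hinit hp, hmap hp] at hmem
    obtain ⟨a, ha, hared⟩ := (Ideal.mem_map_iff_of_surjective _
      (map_surjective _ (ZMod.ringHom_surjective _))).mp hmem
    obtain ⟨g, hg, hgle, hag⟩ := exists_of_mem_initIdeal ha (Finsupp.weight w e)
    have hcoeff : ((coeff e a : ℤ) : ZMod p) = ((coeff e r : ℤ) : ZMod p) := by
      have := congrArg (coeff e) hared
      rw [coeff_map, coeff_weightedHomogeneousComponent, if_pos rfl, reducePoly,
        coeff_map] at this
      exact this
    -- As `p` does not divide the leading coefficient of `r`, the lift `a` contains `x ^ e`. By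
    -- injectivity of the weight this monomial is a whole component of `a`.
    have hane : coeff e a ≠ 0 := by
      intro h0
      rw [h0, Int.cast_zero, eq_comm, ZMod.intCast_zmod_eq_zero_iff_dvd] at hcoeff
      exact hdvd (Int.natCast_dvd.mp hcoeff)
    have hmono := weightedHomogeneousComponent_mem_initIdeal_of_mem ha (Finsupp.weight w e)
    rw [weightedHomogeneousComponent_eq_monomial hinj] at hmono
    have hmonoQ := Ideal.mem_map_of_mem (MvPolynomial.map (Int.castRingHom ℚ)) hmono
    rw [← initIdeal_eq_map, map_monomial] at hmonoQ
    rw [weightedHomogeneousComponent_eq_monomial hinj, map_monomial]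
    have := (initIdeal w J).mul_mem_left (C (((coeff e r : ℤ) : ℚ) * ((coeff e a : ℤ) : ℚ)⁻¹)) hmonoQ
    rw [C_mul_monomial] at this
    simpa [mul_assoc, hane] using this
  obtain ⟨g, hg𝔞, hg, heq⟩ := exists_of_mem_initIdeal (hNmem _ hlead) δ
  rw [weightedHomogeneousComponent_natCast_mul, weightedHomogeneousComponent_self,
    ← weightedHomogeneousComponent_natCast_mul] at heq
  have hr' : WeightLE w δ ((N : MvPolynomial (Fin n) ℤ) * r) := by
    simpa using hδ.C_mul (N : ℤ)
  have hmem := ih _ (hr'.weightLT_sub hg heq) (hfreq.mono fun p hp => ⟨hp.1, by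
    rw [reducePoly_sub, reducePoly_natCast_mul]
    exact Ideal.sub_mem _ (Ideal.mul_mem_left _ _ hp.2) (reducePoly_mem_reduceIdeal hg𝔞)⟩)
  rw [map_sub, map_mul, map_natCast] at hmem
  refine mem_of_natCast_mul_mem hNQ ?_
  simpa using J.add_mem hmem hg𝔞

/-- An integral polynomial that lies in the reduction of `J` modulo infinitely many primes
lies in `J`. -/
theorem map_mem_of_frequently (J : Ideal (MvPolynomial (Fin n) ℚ)) (r : MvPolynomial (Fin n) ℤ)
    (h : ∃ᶠ p : ℕ in cofinite, p.Prime ∧ reducePoly p r ∈ reduceIdeal p J) :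
    MvPolynomial.map (Int.castRingHom ℚ) r ∈ J := by
  -- The statement involves no weighting, so an auxiliary one with injective weights is used: the
  -- lexicographic order, valued in its own exponent monoid.
  let m : MonomialOrder (Fin n) := MonomialOrder.lex
  have hweight : ∀ d : Fin n →₀ ℕ,
      Finsupp.weight (fun i => m.toSyn (Finsupp.single i 1)) d = m.toSyn d := by
    intro d
    rw [Finsupp.weight_apply, Finsupp.sum]
    simp only [← map_nsmul, ← map_sum]
    congr 1
    conv_rhs => rw [← d.sum_single, Finsupp.sum]
    simp
  refine map_mem_of_frequently_of_injective (w := fun i => m.toSyn (Finsupp.single i 1))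
    (fun i => m.zero_le _) ?_ J r h
  intro a b hab
  rw [hweight, hweight] at hab
  exact m.toSyn.injective hab

end Reduction

/-! ### Basic elements of finite posets and intersections. -/

section Poset

variable {V : Type*} [PartialOrder V] {YY : Set V}

theorem basicAbove_subset (YY : Set V) (Y : V) : basicAbove YY Y ⊆ YY :=
  fun _ hZ => hZ.1

/-- In a finite poset every element is the greatest lower bound of the basic elements above it. -/
theorem le_of_forall_le_basicAbove (hfin : YY.Finite) {Y : V} (hY : Y ∈ YY) {b : V} (hb : b ∈ YY)
    (h : ∀ Z ∈ basicAbove YY Y, b ≤ Z) : b ≤ Y := by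
  have := hfin.to_subtype
  suffices H : ∀ Y : YY, (∀ Z ∈ basicAbove YY Y.1, b ≤ Z) → b ≤ Y.1 from H ⟨Y, hY⟩ h
  intro Y
  induction Y using WellFoundedGT.induction with
  | ind Y ih =>
    intro h
    by_cases hB : IsBasic Y
    · exact h Y.1 ⟨Y.2, hB, le_rfl⟩
    · have hglb : IsGLB {q : YY | Y < q} Y := not_not.mp hB
      have hlb : (⟨b, hb⟩ : YY) ∈ lowerBounds {q : YY | Y < q} := fun q hq =>
        ih q hq fun Z hZ => h Z ⟨hZ.1, hZ.2.1, (le_of_lt hq : (Y : V) ≤ q).trans hZ.2.2⟩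
      exact hglb.2 hlb

/-- Intersect the members of `S` one at a time, each time passing to a component that contains `W`.
-/
theorem ClosedUnderComponents.exists_le_of_forall_le (hcl : ClosedUnderComponents YY)
    (hcomp : ∀ Y Z W : V, W ≤ Y → W ≤ Z → ∃ T, Maximal (fun T => T ≤ Y ∧ T ≤ Z) T ∧ W ≤ T)
    {S : Set V} (hS : S.Finite) (hne : S.Nonempty) (hSY : S ⊆ YY) {W : V}
    (hW : ∀ Z ∈ S, W ≤ Z) : ∃ T ∈ YY, W ≤ T ∧ ∀ Z ∈ S, T ≤ Z := by
  induction S, hS using Set.Finite.induction_on with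
  | empty => exact absurd hne Set.not_nonempty_empty
  | @insert Z S _ _ ih =>
    rcases S.eq_empty_or_nonempty with rfl | hSne
    · exact ⟨Z, hSY (Set.mem_insert _ _), hW Z (Set.mem_insert _ _), by simp⟩
    · obtain ⟨T, hT, hWT, hTS⟩ := ih hSne ((Set.subset_insert _ _).trans hSY)
        fun Z' hZ' => hW Z' (Set.mem_insert_of_mem _ hZ')
      obtain ⟨U, hU, hWU⟩ := hcomp Z T W (hW Z (Set.mem_insert _ _)) hWT
      refine ⟨U, hcl Z (hSY (Set.mem_insert _ _)) T hT U hU, hWU, ?_⟩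
      rintro Z' (rfl | hZ')
      · exact hU.prop.1
      · exact hU.prop.2.trans (hTS Z' hZ')

variable {L : Type*} [CompleteLattice L] {I : V → L}

theorem iSup_minimalBasicAbove (hfin : YY.Finite) (hI : ∀ Y Z, Y ≤ Z → I Z ≤ I Y) (Y : V) :
    ⨆ Z ∈ minimalBasicAbove YY Y, I Z = ⨆ Z ∈ basicAbove YY Y, I Z := by
  refine le_antisymm (biSup_mono fun Z hZ => hZ.prop) (iSup₂_le fun Z hZ => ?_)
  obtain ⟨M, hMZ, hM⟩ := (hfin.subset (basicAbove_subset YY Y)).exists_le_minimal hZ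
  exact (hI M Z hMZ).trans (le_iSup₂_of_le M hM le_rfl)

/-- A member of a finite admissible family of subvarieties is the intersection of the basic
members above it, provided that intersections of members of the family are determined by the
subvarieties that they contain. -/
theorem eq_iSup_basicAbove (hfin : YY.Finite) (hI : ∀ Y Z, Y ≤ Z → I Z ≤ I Y)
    (hcl : ClosedUnderComponents YY) (hgreat : ∀ Y, IsGreatest YY Y → I Y = ⊥)
    (hcomp : ∀ Y Z W : V, W ≤ Y → W ≤ Z → ∃ T, Maximal (fun T => T ≤ Y ∧ T ≤ Z) T ∧ W ≤ T)
    (hred : ∀ S ⊆ YY, ∀ b : L, (∀ W, (∀ Z ∈ S, W ≤ Z) → b ≤ I W) → b ≤ ⨆ Z ∈ S, I Z)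
    {Y : V} (hY : Y ∈ YY) : I Y = ⨆ Z ∈ basicAbove YY Y, I Z := by
  refine le_antisymm ?_ (iSup₂_le fun Z hZ => hI Y Z hZ.2.2)
  rcases (basicAbove YY Y).eq_empty_or_nonempty with hempty | hne
  -- With no basic element above it, `Y` is greatest in `YY`, hence the whole space, matching the
  -- empty intersection.
  · rw [hgreat Y ⟨hY, fun b hb => le_of_forall_le_basicAbove hfin hY hb (by simp [hempty])⟩]
    exact bot_le
  · refine hred _ (basicAbove_subset YY Y) _ fun W hW => ?_
    obtain ⟨T, hT, hWT, hTS⟩ := hcl.exists_le_of_forall_le hcomp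
      (hfin.subset (basicAbove_subset YY Y)) hne (basicAbove_subset YY Y) hW
    exact hI W Y (hWT.trans (le_of_forall_le_basicAbove hfin hY hT hTS))

end Poset

/-! ### Components and radical sums in affine schemes. -/

section Affine

variable {R : Type*} [CommRing R]

/-- Components of the intersection are the minimal primes over the sum of the ideals. -/
theorem AffineSubvariety.exists_maximal (Y Z W : AffineSubvariety R) (hY : W ≤ Y) (hZ : W ≤ Z) :
    ∃ T, Maximal (fun T => T ≤ Y ∧ T ≤ Z) T ∧ W ≤ T := by
  have := W.isPrime
  obtain ⟨q, hq, hqW⟩ := Ideal.exists_minimalPrimes_le (I := Y.ideal ⊔ Z.ideal) (J := W.ideal)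
    (sup_le hY hZ)
  refine ⟨⟨q, hq.1.1⟩, ⟨⟨le_sup_left.trans hq.1.2, le_sup_right.trans hq.1.2⟩, ?_⟩, hqW⟩
  intro T hT hqT
  exact hq.2 ⟨T.isPrime, sup_le hT.1 hT.2⟩ hqT

theorem AffineSubvariety.le_of_isRadical {S : Set (AffineSubvariety R)}
    (hS : (⨆ Z ∈ S, Z.ideal).IsRadical) (b : Ideal R)
    (hb : ∀ W : AffineSubvariety R, (∀ Z ∈ S, W ≤ Z) → b ≤ W.ideal) :
    b ≤ ⨆ Z ∈ S, Z.ideal := by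
  rw [← hS.radical, Ideal.radical_eq_sInf]
  refine le_sInf fun q hq => hb ⟨q, hq.2⟩ fun Z hZ => ?_
  exact (le_iSup₂_of_le Z hZ le_rfl).trans hq.1

theorem biSup_induction {L ι : Type*} [CompleteLattice L] {C : L → Prop} (hbot : C ⊥)
    (hsup : ∀ a b, C a → C b → C (a ⊔ b)) {S : Set ι} (hS : S.Finite) {I : ι → L}
    (hI : ∀ i ∈ S, C (I i)) : C (⨆ i ∈ S, I i) := by
  induction S, hS using Set.Finite.induction_on with
  | empty => simpa using hbot
  | insert _ _ ih =>
    rw [iSup_insert]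
    exact hsup _ _ (hI _ (Set.mem_insert _ _)) (ih fun i hi => hI i (Set.mem_insert_of_mem _ hi))

end Affine

/-! ### Lattices of ideals with radical initial ideals. -/

section InitRadical

variable {n : ℕ} {K : Type*} [Field K]
variable {Γ : Type*} [AddCommMonoid Γ] [LinearOrder Γ] [IsOrderedCancelAddMonoid Γ]
variable {w : Fin n → Γ}

/-- A sublattice of ideals whose initial ideals are radical. -/
structure IsInitRadicalLattice (w : Fin n → Γ)
    (C : Ideal (MvPolynomial (Fin n) K) → Prop) : Prop where
  bot : C ⊥
  sup : ∀ I J, C I → C J → C (I ⊔ J)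
  inf : ∀ I J, C I → C J → C (I ⊓ J)
  isRadical : ∀ I, C I → (initIdeal w I).IsRadical

namespace IsInitRadicalLattice

variable {C : Ideal (MvPolynomial (Fin n) K) → Prop}
variable {YY : Set (AffineSubvariety (MvPolynomial (Fin n) K))}

theorem initIdeal_biSup (hC : IsInitRadicalLattice w C) (hw : ∀ i, 0 ≤ w i) {ι : Type*} {S : Set ι}
    (hS : S.Finite) {I : ι → Ideal (MvPolynomial (Fin n) K)} (hI : ∀ i ∈ S, C (I i)) :
    initIdeal w (⨆ i ∈ S, I i) = ⨆ i ∈ S, initIdeal w (I i) := by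
  induction S, hS using Set.Finite.induction_on with
  | empty => simpa using initIdeal_bot
  | @insert a S ha hS ih =>
    have hI' : ∀ i ∈ S, C (I i) := fun i hi => hI i (Set.mem_insert_of_mem _ hi)
    have ha := hI a (Set.mem_insert _ _)
    have hsup := biSup_induction hC.bot hC.sup hS hI'
    rw [iSup_insert, iSup_insert, ← ih hI', initIdeal_sup_of_initIdeal_inf hw
      (initIdeal_inf_of_isRadical (hC.isRadical _ (hC.inf _ _ ha hsup)))]

theorem eq_iSup_basicAbove (hC : IsInitRadicalLattice w C) (hw : ∀ i, 0 ≤ w i)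
    (hfin : YY.Finite) (hYY : ∀ Y ∈ YY, C Y.ideal) (hcl : ClosedUnderComponents YY)
    (hgreat : ∀ Y, IsGreatest YY Y → Y.ideal = ⊥) {Y : AffineSubvariety (MvPolynomial (Fin n) K)}
    (hY : Y ∈ YY) : Y.ideal = ⨆ Z ∈ basicAbove YY Y, Z.ideal := by
  refine _root_.eq_iSup_basicAbove (I := AffineSubvariety.ideal) hfin (fun _ _ h => h) hcl hgreat
    AffineSubvariety.exists_maximal (fun S hS b hb => ?_) hY
  exact AffineSubvariety.le_of_isRadical (isRadical_of_initIdeal hw (hC.isRadical _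
    (biSup_induction hC.bot hC.sup (hfin.subset hS) fun Z hZ => hYY Z (hS hZ)))) b hb

theorem isGroebnerBasis (hC : IsInitRadicalLattice w C) (hw : ∀ i, 0 ≤ w i)
    (hfin : YY.Finite) (hYY : ∀ Y ∈ YY, C Y.ideal) (hcl : ClosedUnderComponents YY)
    (hgreat : ∀ Y, IsGreatest YY Y → Y.ideal = ⊥) {Y : AffineSubvariety (MvPolynomial (Fin n) K)}
    (hY : Y ∈ YY) {G : AffineSubvariety (MvPolynomial (Fin n) K) → Set (MvPolynomial (Fin n) K)}
    (hG : ∀ Z ∈ minimalBasicAbove YY Y, IsGroebnerBasis w Z.ideal (G Z)) :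
    IsGroebnerBasis w Y.ideal (⋃ Z ∈ minimalBasicAbove YY Y, G Z) := by
  have hsub : minimalBasicAbove YY Y ⊆ YY := fun Z hZ => basicAbove_subset YY Y hZ.prop
  have hfin' := hfin.subset hsub
  have heq : Y.ideal = ⨆ Z ∈ minimalBasicAbove YY Y, Z.ideal := by
    rw [iSup_minimalBasicAbove (I := AffineSubvariety.ideal) hfin (fun _ _ h => h)]
    exact hC.eq_iSup_basicAbove hw hfin hYY hcl hgreat hY
  refine ⟨hfin'.biUnion fun Z hZ => (hG Z hZ).finite, ?_, ?_⟩
  · refine Set.iUnion₂_subset fun Z hZ => (hG Z hZ).subset.trans ?_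
    exact fun g hg => hZ.prop.2.2 hg
  · rw [heq, hC.initIdeal_biSup hw hfin' fun Z hZ => hYY Z (hsub hZ), Set.image_iUnion₂]
    refine (Submodule.span_iUnion₂ _).trans ?_
    exact iSup_congr fun Z => iSup_congr fun hZ => (hG Z hZ).span_init

end IsInitRadicalLattice

end InitRadical

/-! ### Squarefree monomial initial ideals. -/

section Squarefree

variable {n : ℕ} {K : Type*} [Field K]
variable {Γ : Type*} [AddCommMonoid Γ] [LinearOrder Γ] [IsOrderedCancelAddMonoid Γ]
variable {w : Fin n → Γ}

/-- `J` is generated by squarefree monomials: with every polynomial it contains the radicals of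
its monomials. -/
def IsSquarefreeMonomial (J : Ideal (MvPolynomial (Fin n) K)) : Prop :=
  ∀ a ∈ J, ∀ e, coeff e a ≠ 0 → ∏ i ∈ e.support, X i ∈ J

variable {I J : Ideal (MvPolynomial (Fin n) K)}

theorem monomial_mem_of_prod_X_mem {e : Fin n →₀ ℕ} (h : ∏ i ∈ e.support, X i ∈ J) (c : K) :
    monomial e c ∈ J := by
  rw [monomial_eq, Finsupp.prod]
  refine J.mul_mem_left _ (Ideal.mem_of_dvd J ?_ h)
  exact Finset.prod_dvd_prod_of_dvd _ _ fun i hi =>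
    dvd_pow_self _ (Finsupp.mem_support_iff.mp hi)

theorem IsSquarefreeMonomial.le (hI : IsSquarefreeMonomial I)
    (h : ∀ S : Finset (Fin n), ∏ i ∈ S, X i ∈ I → ∏ i ∈ S, X i ∈ J) : I ≤ J := by
  intro a ha
  rw [a.as_sum]
  exact J.sum_mem fun e he => monomial_mem_of_prod_X_mem
    (h _ (hI a ha e (mem_support_iff.mp he))) _

theorem exists_initForm_eq_prod_X {S : Finset (Fin n)} (h : ∏ i ∈ S, X i ∈ initIdeal w I) :
    ∃ g ∈ I, initForm w g = ∏ i ∈ S, X i := by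
  have hhom : IsWeightedHomogeneous w (∏ i ∈ S, X i : MvPolynomial (Fin n) K) (∑ i ∈ S, w i) :=
    IsWeightedHomogeneous.prod S _ _ fun i _ => isWeightedHomogeneous_X K w i
  obtain ⟨g, hg, hγ, heq⟩ := exists_of_mem_initIdeal h (∑ i ∈ S, w i)
  rw [weightedHomogeneousComponent_eq_self hhom] at heq
  refine ⟨g, hg, ?_⟩
  rw [hγ.initForm_eq (by rw [← heq]; exact Finset.prod_ne_zero_iff.mpr fun i _ => X_ne_zero i), heq]

theorem IsSquarefreeMonomial.exists_isGroebnerBasis (hI : IsSquarefreeMonomial (initIdeal w I)) :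
    ∃ G : Set (MvPolynomial (Fin n) K), IsGroebnerBasis w I G ∧
      ∀ g ∈ G, ∃ S : Finset (Fin n), initForm w g = ∏ i ∈ S, X i := by
  -- One element of `I` for each squarefree monomial of the initial ideal; there are at most `2 ^ n`
  -- of these.
  choose! g hgI hg using fun S : Finset (Fin n) => exists_initForm_eq_prod_X (w := w) (I := I) (S := S)
  refine ⟨g '' {S | ∏ i ∈ S, X i ∈ initIdeal w I}, ⟨(Set.toFinite _).image _, ?_, ?_⟩, ?_⟩
  · rintro _ ⟨S, hS, rfl⟩
    exact hgI S hS
  · refine le_antisymm (Ideal.span_mono (Set.image_mono ?_)) (hI.le fun S hS => ?_)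
    · rintro _ ⟨S, hS, rfl⟩
      exact hgI S hS
    · rw [← hg S hS]
      exact Ideal.subset_span ⟨g S, ⟨S, hS, rfl⟩, rfl⟩
  · rintro _ ⟨S, hS, rfl⟩
    exact ⟨S, hg S hS⟩

/-- Only finitely many members of an init-radical lattice have initial ideals generated by
squarefree monomials. -/
theorem IsInitRadicalLattice.finite {C : Ideal (MvPolynomial (Fin n) K) → Prop}
    (hC : IsInitRadicalLattice w C) (hw : ∀ i, 0 ≤ w i)
    {YY : Set (AffineSubvariety (MvPolynomial (Fin n) K))} (hYY : ∀ Y ∈ YY, C Y.ideal)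
    (hsq : ∀ Y ∈ YY, IsSquarefreeMonomial (initIdeal w Y.ideal)) : YY.Finite := by
  -- A squarefree monomial ideal is encoded by the set of squarefree monomials in it, and there are
  -- finitely many such sets.
  refine Set.Finite.of_injOn (f := fun Y => {S : Finset (Fin n) |
    (∏ i ∈ S, X i : MvPolynomial (Fin n) K) ∈ initIdeal w Y.ideal}) (t := Set.univ)
    (fun _ _ => Set.mem_univ _) ?_ Set.finite_univ
  intro Y hY Z hZ heq
  have hinit : initIdeal w Y.ideal = initIdeal w Z.ideal :=
    le_antisymm ((hsq Y hY).le fun S hS => heq.subset hS)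
      ((hsq Z hZ).le fun S hS => heq.superset hS)
  exact AffineSubvariety.ext (eq_of_initIdeal_eq hw hinit (initIdeal_inf_of_isRadical
    (hC.isRadical _ (hC.inf _ _ (hYY Y hY) (hYY Z hZ)))))

end Squarefree

/-! ### Subvarieties of schemes as irreducible closed subsets. -/

section Scheme

open AlgebraicGeometry TopologicalSpace

variable {X : Scheme.{u}}

theorem isIrreducible_sUnion_of_isChain {T : Type*} [TopologicalSpace T] {c : Set (Set T)}
    (hc : ∀ s ∈ c, IsIrreducible s) (hchain : IsChain (· ⊆ ·) c) (hne : c.Nonempty) :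
    IsIrreducible (⋃₀ c) := by
  obtain ⟨s, hs⟩ := hne
  refine ⟨(hc s hs).nonempty.mono (Set.subset_sUnion_of_mem hs), ?_⟩
  rintro u v hu hv ⟨y, ⟨p, hp, hyp⟩, hyu⟩ ⟨x, ⟨q, hq, hxq⟩, hxv⟩
  obtain ⟨r, hr, hpr, hqr⟩ : ∃ r ∈ c, p ⊆ r ∧ q ⊆ r := by
    rcases hchain.total hp hq with h | h
    · exact ⟨q, hq, h, subset_rfl⟩
    · exact ⟨p, hp, subset_rfl, h⟩
  obtain ⟨z, hzr, hz⟩ := (hc r hr).2 u v hu hv ⟨y, hpr hyp, hyu⟩ ⟨x, hqr hxq, hxv⟩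
  exact ⟨z, ⟨r, hr, hzr⟩, hz⟩

namespace SchemeSubvariety

theorem isRadical (Y : SchemeSubvariety X) (U : X.affineOpens) : (Y.ideal.ideal U).IsRadical := by
  have := Y.isIntegral
  rw [← Y.ideal.ker_subschemeι_app U]
  exact RingHom.ker_isRadical_iff_reduced_of_surjective
    (Y.ideal.subschemeι_app_surjective U) |>.mpr inferInstance

/-- Being reduced, a subvariety is recovered from its support, so inclusions can be tested on closed
sets. -/
theorem vanishingIdeal_support (Y : SchemeSubvariety X) :
    Scheme.IdealSheafData.vanishingIdeal Y.ideal.support = Y.ideal := by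
  rw [Scheme.IdealSheafData.vanishingIdeal_support]
  ext U : 2
  exact (Y.isRadical U).radical

theorem isIrreducible_support (Y : SchemeSubvariety X) :
    IsIrreducible (Y.ideal.support : Set X) := by
  have := Y.isIntegral
  rw [← Y.ideal.range_subschemeι, ← Set.image_univ]
  exact (IrreducibleSpace.isIrreducible_univ _).image _ Y.ideal.subschemeι.continuous.continuousOn

/-- An irreducible closed subset with its reduced scheme structure. -/
def ofIsIrreducible (C : Closeds X) (hC : IsIrreducible (C : Set X)) : SchemeSubvariety X where
  ideal := Scheme.IdealSheafData.vanishingIdeal C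
  isIntegral := by
    have h1 : IrreducibleSpace (Scheme.IdealSheafData.vanishingIdeal C).subscheme :=
      Subtype.irreducibleSpace hC
    have h2 : AlgebraicGeometry.IsReduced (Scheme.IdealSheafData.vanishingIdeal C).subscheme := by
      have hU (U : X.affineOpens) : AlgebraicGeometry.IsReduced
          ((Scheme.IdealSheafData.vanishingIdeal C).subschemeCover.openCover.X U) := by
        have : _root_.IsReduced (Γ(X, U) ⧸ (Scheme.IdealSheafData.vanishingIdeal C).ideal U) :=
          (Ideal.isRadical_iff_quotient_reduced _).mp
            (PrimeSpectrum.isRadical_vanishingIdeal _)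
        exact inferInstanceAs (AlgebraicGeometry.IsReduced (Spec (.of
          (Γ(X, U) ⧸ (Scheme.IdealSheafData.vanishingIdeal C).ideal U))))
      exact @IsReduced.of_openCover _
        (Scheme.IdealSheafData.vanishingIdeal C).subschemeCover.openCover hU
    exact isIntegral_of_irreducibleSpace_of_isReduced _

theorem le_iff_support_le {Y Z : SchemeSubvariety X} :
    Y ≤ Z ↔ Y.ideal.support ≤ Z.ideal.support := by
  rw [Scheme.IdealSheafData.le_support_iff_le_vanishingIdeal, vanishingIdeal_support]
  rfl

theorem ofIsIrreducible_le_iff {C : Closeds X} {hC : IsIrreducible (C : Set X)}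
    {Z : SchemeSubvariety X} : ofIsIrreducible C hC ≤ Z ↔ C ≤ Z.ideal.support :=
  Scheme.IdealSheafData.le_support_iff_le_vanishingIdeal.symm

theorem exists_maximal (Y Z W : SchemeSubvariety X) (hY : W ≤ Y) (hZ : W ≤ Z) :
    ∃ T, Maximal (fun T => T ≤ Y ∧ T ≤ Z) T ∧ W ≤ T := by
  obtain ⟨C, hWC, hC⟩ := zorn_subset_nonempty
    {C : Set X | IsIrreducible C ∧ C ⊆ Y.ideal.support ∩ Z.ideal.support}
    (fun c hc hchain hne => ⟨⋃₀ c,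
      ⟨isIrreducible_sUnion_of_isChain (fun s hs => (hc hs).1) hchain hne,
        Set.sUnion_subset fun s hs => (hc hs).2⟩, fun s hs => Set.subset_sUnion_of_mem hs⟩)
    W.ideal.support ⟨W.isIrreducible_support,
      Set.subset_inter (le_iff_support_le.mp hY) (le_iff_support_le.mp hZ)⟩
  -- Zorn's lemma runs over all irreducible subsets; the closure of one is again irreducible, so a
  -- maximal one is closed.
  have hclosed : IsClosed C := by
    have hmem : closure C ∈ {C : Set X | IsIrreducible C ∧
        C ⊆ Y.ideal.support ∩ Z.ideal.support} :=
      ⟨hC.prop.1.closure, closure_minimal hC.prop.2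
        (Y.ideal.support.isClosed.inter Z.ideal.support.isClosed)⟩
    exact isClosed_of_closure_subset (hC.2 hmem subset_closure)
  refine ⟨ofIsIrreducible ⟨C, hclosed⟩ hC.prop.1, ⟨⟨ofIsIrreducible_le_iff.mpr
    fun x hx => (hC.prop.2 hx).1, ofIsIrreducible_le_iff.mpr fun x hx => (hC.prop.2 hx).2⟩, ?_⟩, ?_⟩
  · intro T hT hle
    have h1 : C ⊆ T.ideal.support := ofIsIrreducible_le_iff.mp hle
    have h2 : (T.ideal.support : Set X) ⊆ C := hC.2 ⟨T.isIrreducible_support, Set.subset_inter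
      (le_iff_support_le.mp hT.1) (le_iff_support_le.mp hT.2)⟩ h1
    change Scheme.IdealSheafData.vanishingIdeal _ ≤ T.ideal
    rw [← T.vanishingIdeal_support]
    exact Scheme.IdealSheafData.vanishingIdeal_antimono h2
  · change Scheme.IdealSheafData.vanishingIdeal _ ≤ W.ideal
    rw [← W.vanishingIdeal_support]
    exact Scheme.IdealSheafData.vanishingIdeal_antimono hWC

/-- A radical ideal sheaf is the vanishing ideal of its support, and each point `x` of the support
is reached by taking for `W` the closure of `x`. -/
theorem le_of_isRadical {S : Set (SchemeSubvariety X)}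
    (hS : ∀ U, ((⨆ Z ∈ S, Z.ideal).ideal U).IsRadical) (b : X.IdealSheafData)
    (hb : ∀ W : SchemeSubvariety X, (∀ Z ∈ S, W ≤ Z) → b ≤ W.ideal) :
    b ≤ ⨆ Z ∈ S, Z.ideal := by
  have hrad : (⨆ Z ∈ S, Z.ideal) =
      Scheme.IdealSheafData.vanishingIdeal (⨆ Z ∈ S, Z.ideal).support := by
    rw [Scheme.IdealSheafData.vanishingIdeal_support]
    ext U : 2
    exact (hS U).radical.symm
  rw [hrad, ← Scheme.IdealSheafData.le_support_iff_le_vanishingIdeal]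
  intro x hx
  have hC : Closeds.closure {x} ≤ (⨆ Z ∈ S, Z.ideal).support :=
    closure_minimal (Set.singleton_subset_iff.mpr hx) (⨆ Z ∈ S, Z.ideal).support.isClosed
  have hle := hb (ofIsIrreducible (Closeds.closure {x}) isIrreducible_singleton.closure)
    fun Z hZ => ofIsIrreducible_le_iff.mpr
      (hC.trans (Scheme.IdealSheafData.support_antitone (le_iSup₂_of_le Z hZ le_rfl)))
  exact Scheme.IdealSheafData.le_support_iff_le_vanishingIdeal.mpr hle
    (subset_closure (Set.mem_singleton x))

end SchemeSubvariety

end Scheme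

/-! ### Splittings provide lattices with radical initial ideals. -/

section Splittings

open Filter

theorem SchemeSubvariety.eq_iSup_basicAbove {p : ℕ} (hp : p.Prime)
    {X : AlgebraicGeometry.Scheme.{u}} (φ : SchemeFrobeniusSplitting p X)
    {YY : Set (SchemeSubvariety X)} (hfin : YY.Finite) (hYY : ∀ Y ∈ YY, Y.IsCompatiblySplit φ)
    (hcl : ClosedUnderComponents YY) (hgreat : ∀ Y, IsGreatest YY Y → Y.ideal = ⊥)
    {Y : SchemeSubvariety X} (hY : Y ∈ YY) : Y.ideal = ⨆ Z ∈ basicAbove YY Y, Z.ideal := by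
  refine _root_.eq_iSup_basicAbove (I := SchemeSubvariety.ideal) hfin (fun _ _ h => h) hcl hgreat
    SchemeSubvariety.exists_maximal (fun S hS b hb => ?_) hY
  refine SchemeSubvariety.le_of_isRadical (fun U => ?_) b hb
  have hadd := (φ.isSplitting U).map_add
  refine (φ.isSplitting U).isRadical hp.one_lt (biSup_induction
    (C := fun J : X.IdealSheafData => _root_.IsCompatiblySplit (φ.toFun U) (J.ideal U))
    ?_ (fun _ _ hI hJ => hI.sup hadd hJ) (hfin.subset hS) fun Z hZ => hYY Z (hS hZ) U)
  intro a ha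
  rw [Ideal.mem_bot.mp ha]
  exact Ideal.mem_bot.mpr (by simpa using hadd 0 0)

variable {n : ℕ} {Γ : Type*} [AddCommMonoid Γ] [LinearOrder Γ] [IsOrderedCancelAddMonoid Γ]
variable {w : Fin n → Γ}

theorem isCompatiblySplit_traceMap_bot {p : ℕ} (hp : 0 < p) (f : MvPolynomial (Fin n) (ZMod p)) :
    IsCompatiblySplit (traceMap p f) ⊥ := by
  intro a ha
  rw [Ideal.mem_bot.mp ha]
  exact Ideal.mem_bot.mpr (by simpa using traceMap_add hp f 0 0)

theorem isInitRadicalLattice_zmod {p : ℕ} (hp : p.Prime) (f : MvPolynomial (Fin n) (ZMod p))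
    (hf : IsFrobeniusSplitting p (traceMap p (initForm w f))) :
    have := Fact.mk hp
    IsInitRadicalLattice w (IsCompatiblySplit (traceMap p f)) := by
  have := Fact.mk hp
  refine ⟨isCompatiblySplit_traceMap_bot hp.pos f,
    fun I J hI hJ => hI.sup (traceMap_add hp.pos f) hJ, fun I J hI hJ => hI.inf hJ,
    fun I hI => ?_⟩
  obtain ⟨γ, hγ, heq⟩ := exists_initForm_eq w f
  rw [heq] at hf
  exact hf.isRadical hp.one_lt (hI.initIdeal hp.pos hγ)

/-- The ideal `I` is compatibly split modulo almost all primes in `P`. -/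
def IsEventuallyCompatiblySplit (f : MvPolynomial (Fin n) ℤ) (P : Set ℕ)
    (I : Ideal (MvPolynomial (Fin n) ℚ)) : Prop :=
  ∀ᶠ p : ℕ in cofinite, p ∈ P → IsCompatiblySplit (traceMap p (reducePoly p f)) (reduceIdeal p I)

variable {f : MvPolynomial (Fin n) ℤ} {P : Set ℕ}

theorem IsCompatiblySplitOver.eventually {Y : AffineSubvariety (MvPolynomial (Fin n) ℚ)}
    (hY : IsCompatiblySplitOver f P Y) : IsEventuallyCompatiblySplit f P Y.ideal :=
  Eventually.of_forall hY

/-- Modulo almost all primes in `P`, the initial ideal is compatibly split by the trace map of the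
initial form of `f`. -/
theorem IsEventuallyCompatiblySplit.initIdeal (hw : ∀ i, 0 ≤ w i) (hP : ∀ p ∈ P, p.Prime)
    {I : Ideal (MvPolynomial (Fin n) ℚ)} (hI : IsEventuallyCompatiblySplit f P I) :
    IsEventuallyCompatiblySplit (initForm w f) P (initIdeal w I) := by
  obtain ⟨γ, hγ, heq⟩ := exists_initForm_eq w f
  filter_upwards [hI, eventually_initIdeal_reduceIdeal hw I] with p hp hinit hpP
  rw [hinit (hP p hpP), heq, reducePoly, map_weightedHomogeneousComponent]
  exact (hp hpP).initIdeal (hP p hpP).pos (hγ.map _)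

/-- Finitely many primes must be discarded, depending on the ideals, for reduction to commute with
`⊔` and `⊓`; hence the splitting condition modulo almost all primes. Radicality holds mod `p` and
lifts by `map_mem_of_frequently`. -/
theorem isInitRadicalLattice_rat (hw : ∀ i, 0 ≤ w i) (hPinf : P.Infinite)
    (hP : ∀ p ∈ P, p.Prime)
    (hf : ∀ p ∈ P, IsFrobeniusSplitting p (traceMap p (reducePoly p (initForm w f)))) :
    IsInitRadicalLattice w (IsEventuallyCompatiblySplit f P) := by
  refine ⟨Eventually.of_forall fun p hp => ?_, fun I J hI hJ => ?_, fun I J hI hJ => ?_,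
    fun I hI => ?_⟩
  · have h0 : reduceIdeal p (⊥ : Ideal (MvPolynomial (Fin n) ℚ)) = ⊥ := by
      rw [reduceIdeal, Ideal.comap_bot_of_injective _ map_intCast_injective, Ideal.map_bot]
    rw [h0]
    exact isCompatiblySplit_traceMap_bot (hP p hp).pos _
  · filter_upwards [hI, hJ, eventually_reduceIdeal_sup I J] with p hI hJ hsup hp
    rw [hsup (hP p hp)]
    exact (hI hp).sup (traceMap_add (hP p hp).pos _) (hJ hp)
  · filter_upwards [hI, hJ, eventually_reduceIdeal_inf I J] with p hI hJ hinf hp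
    rw [hinf (hP p hp)]
    exact (hI hp).inf (hJ hp)
  · rintro a ⟨m, hm⟩
    obtain ⟨N, hN, z, hz⟩ := exists_natCast_mul_eq_map a
    refine mem_of_natCast_mul_mem (N := N) (by exact_mod_cast hN) ?_
    rw [← hz]
    refine map_mem_of_frequently _ _ (((frequently_cofinite_iff_infinite.mpr hPinf).and_eventually
      (hI.initIdeal hw hP)).mono ?_)
    rintro p ⟨hp, hsplit⟩
    refine ⟨hP p hp, (hf p hp).isRadical (hP p hp).one_lt (hsplit hp) ⟨m, ?_⟩⟩
    rw [reducePoly, ← map_pow]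
    refine reducePoly_mem_reduceIdeal ?_
    rw [map_pow, hz, mul_pow]
    exact Ideal.mul_mem_left _ _ hm

theorem reducePoly_prod_X (p : ℕ) (S : Finset (Fin n)) :
    reducePoly p (∏ i ∈ S, X i) = ∏ i ∈ S, X i := by
  simp [reducePoly]

theorem IsEventuallyCompatiblySplit.isSquarefreeMonomial (hPinf : P.Infinite)
    (hP : ∀ p ∈ P, p.Prime) {J : Ideal (MvPolynomial (Fin n) ℚ)}
    (hJ : IsEventuallyCompatiblySplit (∏ i, X i) P J) : IsSquarefreeMonomial J := by
  intro a ha e he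
  obtain ⟨N, hN, z, hz⟩ := exists_natCast_mul_eq_map a
  have hze : coeff e z ≠ 0 := by
    intro h0
    have := congrArg (coeff e) hz
    rw [coeff_map, ← nsmul_eq_mul, coeff_smul, h0, map_zero, nsmul_eq_mul] at this
    exact mul_ne_zero (Nat.cast_ne_zero.mpr hN) he this.symm
  -- For such `p` all exponents in `z` are below `p`, as `prod_X_mem_of_isCompatiblySplit` requires.
  have hbig : ∀ᶠ p : ℕ in cofinite, z.totalDegree < p :=
    eventually_cofinite.mpr ((Set.finite_Iic z.totalDegree).subset fun p hp => not_lt.mp hp)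
  have hprod : MvPolynomial.map (Int.castRingHom ℚ) (∏ i ∈ e.support, X i) ∈ J := by
    refine map_mem_of_frequently _ _ (((frequently_cofinite_iff_infinite.mpr hPinf).and_eventually
      (hJ.and ((eventually_not_dvd (Int.natAbs_ne_zero.mpr hze)).and
        hbig))).mono ?_)
    rintro p ⟨hp, hsplit, hdvd, hdeg⟩
    have := Fact.mk (hP p hp)
    refine ⟨hP p hp, ?_⟩
    rw [reducePoly_prod_X]
    have hsplit := hsplit hp
    rw [reducePoly_prod_X] at hsplit
    refine prod_X_mem_of_isCompatiblySplit hsplit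
      (reducePoly_mem_reduceIdeal (h := z) (by rw [hz]; exact J.mul_mem_left _ ha)) ?_ ?_
    · intro d hd i
      have hd' : d ∈ z.support := by
        rw [mem_support_iff]
        intro h0
        rw [reducePoly, coeff_map, h0, map_zero] at hd
        exact hd rfl
      refine lt_of_le_of_lt ?_ hdeg
      exact (Finsupp.le_degree i d).trans (le_totalDegree hd')
    · rw [reducePoly, coeff_map]
      intro h0
      exact hdvd (Int.natCast_dvd.mp ((ZMod.intCast_zmod_eq_zero_iff_dvd _ _).mp h0))
  simpa using hprod

end Splittings

end

theorem theorem1p9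
    {n : ℕ} {Γ : Type*} [AddCommMonoid Γ] [LinearOrder Γ] [IsOrderedCancelAddMonoid Γ]
    -- a weighting of the variables
    (w : Fin n → Γ) (hw : ∀ i, 0 ≤ w i) :
    -- the three parts over the rationals
    (∀ f : MvPolynomial (Fin n) ℤ, f.totalDegree = n → initForm w f = ∏ i, X i →
      ∀ P : Set ℕ, P.Infinite → (∀ p ∈ P, p.Prime) →
      ∀ YY : Set (AffineSubvariety (MvPolynomial (Fin n) ℚ)),
        (∀ Y ∈ YY, IsCompatiblySplitOver f P Y) →
        -- (1)
        (∀ Y ∈ YY, ∃ G : Set (MvPolynomial (Fin n) ℚ), IsGroebnerBasis w Y.ideal G ∧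
          ∀ g ∈ G, ∃ S : Finset (Fin n), initForm w g = ∏ i ∈ S, X i) ∧
        (ClosedUnderComponents YY → (∀ Y, IsGreatest YY Y → Y.ideal = ⊥) →
          ∀ Y ∈ YY,
            -- (2)
            Y.ideal = ⨆ Z ∈ basicAbove YY Y, Z.ideal ∧
            Y.ideal = ⨆ Z ∈ minimalBasicAbove YY Y, Z.ideal ∧
            -- (3)
            ∀ G : AffineSubvariety (MvPolynomial (Fin n) ℚ) → Set (MvPolynomial (Fin n) ℚ),
              (∀ Z ∈ minimalBasicAbove YY Y, IsGroebnerBasis w Z.ideal (G Z)) →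
              IsGroebnerBasis w Y.ideal (⋃ Z ∈ minimalBasicAbove YY Y, G Z))) ∧
    -- (2) in any Frobenius split scheme
    (∀ (p : ℕ) (_ : p.Prime) (X : AlgebraicGeometry.Scheme.{u})
      (φ : SchemeFrobeniusSplitting p X) (YY : Set (SchemeSubvariety X)),
        YY.Finite → (∀ Y ∈ YY, Y.IsCompatiblySplit φ) →
        ClosedUnderComponents YY → (∀ Y, IsGreatest YY Y → Y.ideal = ⊥) →
        ∀ Y ∈ YY,
          Y.ideal = ⨆ Z ∈ basicAbove YY Y, Z.ideal ∧
          Y.ideal = ⨆ Z ∈ minimalBasicAbove YY Y, Z.ideal) ∧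
    -- (3) over the rationals whenever `Tr((init f)^{p-1} •)` is a splitting
    (∀ f : MvPolynomial (Fin n) ℤ, ∀ P : Set ℕ, P.Infinite → (∀ p ∈ P, p.Prime) →
      (∀ p ∈ P, IsFrobeniusSplitting p (traceMap p (reducePoly p (initForm w f)))) →
      ∀ YY : Set (AffineSubvariety (MvPolynomial (Fin n) ℚ)),
        YY.Finite → (∀ Y ∈ YY, IsCompatiblySplitOver f P Y) →
        ClosedUnderComponents YY → (∀ Y, IsGreatest YY Y → Y.ideal = ⊥) →
        ∀ Y ∈ YY,
          ∀ G : AffineSubvariety (MvPolynomial (Fin n) ℚ) → Set (MvPolynomial (Fin n) ℚ),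
            (∀ Z ∈ minimalBasicAbove YY Y, IsGroebnerBasis w Z.ideal (G Z)) →
            IsGroebnerBasis w Y.ideal (⋃ Z ∈ minimalBasicAbove YY Y, G Z)) ∧
    -- (3) over `𝔽_p` whenever `Tr((init f)^{p-1} •)` is a splitting
    (∀ (p : ℕ) (_ : p.Prime) (f : MvPolynomial (Fin n) (ZMod p)),
      IsFrobeniusSplitting p (traceMap p (initForm w f)) →
      ∀ YY : Set (AffineSubvariety (MvPolynomial (Fin n) (ZMod p))),
        YY.Finite → (∀ Y ∈ YY, IsCompatiblySplit (traceMap p f) Y.ideal) →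
        ClosedUnderComponents YY → (∀ Y, IsGreatest YY Y → Y.ideal = ⊥) →
        ∀ Y ∈ YY,
          ∀ G : AffineSubvariety (MvPolynomial (Fin n) (ZMod p)) →
              Set (MvPolynomial (Fin n) (ZMod p)),
            (∀ Z ∈ minimalBasicAbove YY Y, IsGroebnerBasis w Z.ideal (G Z)) →
            IsGroebnerBasis w Y.ideal (⋃ Z ∈ minimalBasicAbove YY Y, G Z)) := by
  refine ⟨?_, ?_, ?_, ?_⟩
  · intro f _ hf P hPinf hP YY hYY
    have hsplit : ∀ p ∈ P, IsFrobeniusSplitting p (traceMap p (reducePoly p (initForm w f))) := by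
      intro p hp
      have := Fact.mk (hP p hp)
      rw [hf, reducePoly_prod_X]
      exact isFrobeniusSplitting_traceMap_prod_X
    have hC := isInitRadicalLattice_rat hw hPinf hP hsplit
    have hYC : ∀ Y ∈ YY, IsEventuallyCompatiblySplit f P Y.ideal := fun Y hY => (hYY Y hY).eventually
    have hsq : ∀ Y ∈ YY, IsSquarefreeMonomial (initIdeal w Y.ideal) := by
      intro Y hY
      have := (hYC Y hY).initIdeal hw hP
      rw [hf] at this
      exact this.isSquarefreeMonomial hPinf hP
    -- Finiteness of the family is a consequence here, through its squarefree initial ideals.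
    have hfin := hC.finite hw hYC hsq
    refine ⟨fun Y hY => (hsq Y hY).exists_isGroebnerBasis, fun hcl hgreat Y hY => ?_⟩
    have heq := hC.eq_iSup_basicAbove hw hfin hYC hcl hgreat hY
    exact ⟨heq, heq.trans
      (iSup_minimalBasicAbove (I := AffineSubvariety.ideal) hfin (fun _ _ h => h) Y).symm,
      fun G hG => hC.isGroebnerBasis hw hfin hYC hcl hgreat hY hG⟩
  · intro p hp X φ YY hfin hYY hcl hgreat Y hY
    have heq := SchemeSubvariety.eq_iSup_basicAbove hp φ hfin hYY hcl hgreat hY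
    exact ⟨heq, heq.trans
      (iSup_minimalBasicAbove (I := SchemeSubvariety.ideal) hfin (fun _ _ h => h) Y).symm⟩
  · intro f P hPinf hP hsplit YY hfin hYY hcl hgreat Y hY G hG
    exact (isInitRadicalLattice_rat hw hPinf hP hsplit).isGroebnerBasis hw hfin
      (fun Y hY => (hYY Y hY).eventually) hcl hgreat hY hG
  · intro p hp f hsplit YY hfin hYY hcl hgreat Y hY G hG
    have := Fact.mk hp
    exact (isInitRadicalLattice_zmod hp f hsplit).isGroebnerBasis hw hfin hYY hcl hgreat hY hG
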